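/- **Setting.** Graphs are finite, simple and undirected. The conductance of $G=(V,E)$ is $$\phi_G=\min_{\emptyset\ne S\subsetneq V}\frac{|\{(u,v)\in E:u\in S,\ v\in V\setminus S\}|}{\min\{\sum_{u\in S}d_u,\ \sum_{u\in V\setminus S}d_u\}}$$ (with $\phi_G=0$ if $G$ has an isolated vertex or only one vertex), and "expander" means that $\phi_G$ is at least a positive constant. The effective resistance is $r_G(s,t)=(\mathbf e_s-\mathbf e_t)^T L^\dagger(\mathbf e_s-\mathbf e_t)$ with $L$ the Laplacian of $G$ and $L^\dagger$ its Moore–Penrose pseudo-inverse. A number $x$ is an $\epsilon$-approximation of $y$ if $(1-\epsilon)y\le x\le(1+\epsilon)y$. A randomized local algorithm in the adjacency-query model knows the vertex set $V$ and accesses the graph only through degree queries ($u\mapsto d_u$), neighbor queries ($(u,i)\mapsto$ the $i$-th entry of the adjacency list of $u$) and jump queries (a fresh uniformly random vertex). Adjacency lists may be ordered arbitrarily, and algorithms must succeed for every ordering. **Theorem.** (1) There are constants $\phi,c>0$ such that for every $\epsilon\in(0,1)$ and every $N$ there are a graph $G$ with at least $N$ vertices and $\phi_G\ge\phi$, and vertices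 $s,t$ of $G$, with the following property. Let $A$ be any randomized local algorithm that, for every graph $G'$ on the vertex set of $G$ with $\phi_{G'}\ge\phi$, outputs an $\epsilon$-approximation of $r_{G'}(s,t)$ with probability at least $2/3$. Then, for every ordering of the adjacency lists of $G$, the expected (hence also the worst-case) number of queries of $A$ on $G$ is at least $c/\epsilon$. (2) Let $S_1,S_2$ be disjoint finite sets with $|S_1|=n_1$, $|S_2|=n_2$, let $H$ be a $d$-regular graph on $S_1$, let $d_s\in\mathbb N$, and let $s,t$ be two further vertices. For $N_1\subseteq S_1$, $N_2\subseteq S_2$ let $G(N_1,N_2)$ be the graph on $S_1\cup S_2\cup\{s,t\}$ that has the edges of $H$, the edges from $s$ to all vertices of $N_1\cup N_2$, and the edges from $t$ to all vertices of $S_1\cup S_2$. Put $x=\lfloor(1-\epsilon)d_s\rfloor$, and let $$\mathcal C_1=\{G(N_1,\emptyset):|N_1|=d_s\},\qquad \mathcal C_2=\{G(N_1,N_2):|N_1|=x,\ |N_2|=d_s-x\}.$$ Call $(S_1,S_2,H,d,d_s)$ *$(\phi,K,\epsilon)$-admissible* if $\phi_H\ge\phi$, $\;d_s\ge K/\epsilon$,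 $\;d_s\le n_2$, $\;Kn_2\le n_1$, $\;d\ge\max\{d_s\log n_1,\log^2 n_1\}$ and $n_1\ge 2d^3$. There is an absolute constant $c>0$ such that for every $\phi>0$ there are $K,\phi'>0$ such that for every $\epsilon\in(0,1)$ and every $(\phi,K,\epsilon)$-admissible choice: (a) all $G_1\in\mathcal C_1$ and $G_2\in\mathcal C_2$ are expanders, $\phi_{G_1},\phi_{G_2}\ge\phi'$, and $$|r_{G_1}(s,t)-r_{G_2}(s,t)|>\tfrac{\epsilon}{4}\,r_{G_1}(s,t);$$ (b) if a randomized local algorithm distinguishes $\mathcal C_1$ from $\mathcal C_2$ (it answers "1" on every graph of $\mathcal C_1$ and "2" on every graph of $\mathcal C_2$, each with probability at least $2/3$), then its expected number of queries on every $G_1\in\mathcal C_1$, for every ordering of the adjacency lists, is at least $c/\epsilon$. (3) There is $\phi>0$ such that for all $K>0$, $\epsilon\in(0,1)$ and $N$ there is a $(\phi,K,\epsilon)$-admissible choice with $n_1\ge N$. -/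

import Mathlib

noncomputable section

namespace ERLower

/-! ### Conductance and effective resistance of a finite simple graph -/

open Classical in
/-- The volume `∑_{u ∈ S} d_u` of a vertex set. -/
def vol {V : Type} [Fintype V] (G : SimpleGraph V) (S : Finset V) : ℕ :=
  ∑ u ∈ S, G.degree u

open Classical in
/-- The number of edges leaving `S`; each edge is counted once, from its endpoint in `S`. -/
def cut {V : Type} [Fintype V] (G : SimpleGraph V) (S : Finset V) : ℕ :=
  (Finset.univ.filter fun p : V × V => p.1 ∈ S ∧ p.2 ∉ S ∧ G.Adj p.1 p.2).card

open Classical in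
/-- The conductance: the minimum of `cut S / min (vol S, vol Sᶜ)` over the nonempty proper vertex
sets `S`. It is `0` if `G` is disconnected or has an isolated vertex (`0 / 0 = 0`) or has at most
one vertex. -/
def conductance {V : Type} [Fintype V] (G : SimpleGraph V) : ℝ :=
  ⨅ S : {S : Finset V // S.Nonempty ∧ Sᶜ.Nonempty},
    (cut G S.1 : ℝ) / min (vol G S.1 : ℝ) (vol G (S.1)ᶜ : ℝ)

open Classical in
/-- The Moore-Penrose pseudo-inverse of a real symmetric matrix: invert the nonzero eigenvalues in
an orthonormal eigenbasis, and keep the zero eigenvalues (`0⁻¹ = 0`). -/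
def pinv {V : Type} [Fintype V] (A : Matrix V V ℝ) (hA : A.IsHermitian) : Matrix V V ℝ :=
  (hA.eigenvectorUnitary : Matrix V V ℝ) *
    Matrix.diagonal (fun i => (hA.eigenvalues i)⁻¹) *
    star (hA.eigenvectorUnitary : Matrix V V ℝ)

open Classical in
/-- The graph Laplacian `D - A`. -/
def laplacian {V : Type} [Fintype V] (G : SimpleGraph V) : Matrix V V ℝ :=
  G.lapMatrix ℝ

theorem laplacian_isHermitian {V : Type} [Fintype V] (G : SimpleGraph V) :
    (laplacian G).IsHermitian := by
  classical
  have h : (laplacian G).IsSymm := SimpleGraph.isSymm_lapMatrix ℝ G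
  unfold Matrix.IsHermitian
  rw [Matrix.conjTranspose_eq_transpose_of_trivial]
  exact h

open Classical in
/-- The effective resistance `(e_s - e_t)ᵀ L† (e_s - e_t)`. -/
def effRes {V : Type} [Fintype V] (G : SimpleGraph V) (s t : V) : ℝ :=
  let b : V → ℝ := Pi.single s 1 - Pi.single t 1
  b ⬝ᵥ (pinv (laplacian G) (laplacian_isHermitian G)).mulVec b

/-! ### The adjacency-query model -/

/-- The queries: the degree of `u`, the `i`-th neighbour of `u` (counted from `0`), and a uniformly
random vertex. -/
inductive Query (V : Type) : Type where
  | degree (u : V) : Query V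
  | neighbor (u : V) (i : ℕ) : Query V
  | jump : Query V

/-- The answers: a degree, or a vertex (`none` if a neighbour index is out of range). -/
inductive Answer (V : Type) : Type where
  | degree (k : ℕ) : Answer V
  | vertex (v : Option V) : Answer V

open Classical in
/-- An adjacency-list representation of `G`: an ordering of the neighbours of every vertex. -/
def AdjLists {V : Type} [Fintype V] (G : SimpleGraph V) : Type :=
  (v : V) → Fin (G.degree v) ≃ G.neighborSet v

open Classical in
/-- The law of the answer to each query; every jump query draws a fresh uniform vertex. -/
def oracle {V : Type} [Fintype V] [Nonempty V] (G : SimpleGraph V) (σ : AdjLists G) :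
    Query V → PMF (Answer V)
  | .degree u => PMF.pure (.degree (G.degree u))
  | .neighbor u i =>
      PMF.pure (.vertex (if h : i < G.degree u then some (σ u ⟨i, h⟩ : V) else none))
  | .jump => (PMF.uniformOfFintype V).map fun v => .vertex (some v)

/-- A randomized query algorithm with vertex set `V` and outputs in `α`. In memory state `m` it
tosses coins and then either stops with an output or moves to a new memory state and asks a query;
the answer updates the memory. The memory is unrestricted. -/
structure Algo (V α : Type) : Type 1 where
  State : Type
  init : State
  next : State → PMF ((State × Query V) ⊕ α)
  receive : State → Answer V → State

namespace Algo

variable {V α : Type}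

/-- The law of the outcome from memory state `m` with a budget of `k` queries: `some a` if the
algorithm outputs `a` after at most `k` queries, `none` if it asks a `(k + 1)`-st query. -/
def run (A : Algo V α) (O : Query V → PMF (Answer V)) : ℕ → A.State → PMF (Option α)
  | 0, m => (A.next m).bind fun act =>
      match act with
      | .inl _ => PMF.pure none
      | .inr a => PMF.pure (some a)
  | k + 1, m => (A.next m).bind fun act =>
      match act with
      | .inl mq => (O mq.2).bind fun ans => run A O k (A.receive mq.1 ans)
      | .inr a => PMF.pure (some a)

/-- The probability that the algorithm stops with an output in `good`. -/
def successProb (A : Algo V α) (O : Query V → PMF (Answer V)) (good : Set α) : ENNReal :=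
  ⨆ k : ℕ, (A.run O k A.init).toOuterMeasure (some '' good)

/-- The expected number `∑_k P(more than k queries)` of queries (it is `∞` if the algorithm runs
forever with positive probability). It is a lower bound for the worst-case number of queries. -/
def expectedQueries (A : Algo V α) (O : Query V → PMF (Answer V)) : ENNReal :=
  ∑' k : ℕ, A.run O k A.init none

end Algo

/-- `x ≈_ε y`. -/
def Approx (ε x y : ℝ) : Prop := (1 - ε) * y ≤ x ∧ x ≤ (1 + ε) * y

/-- `A` computes, with probability at least `2/3`, an `ε`-approximation of the `s,t`-resistance of
every graph on `V` of conductance at least `φ`, however its adjacency lists are ordered. -/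
def ApproximatesER {V : Type} [Fintype V] [Nonempty V] (φ ε : ℝ) (s t : V) (A : Algo V ℝ) : Prop :=
  ∀ (G : SimpleGraph V) (σ : AdjLists G), φ ≤ conductance G →
    2 / 3 ≤ A.successProb (oracle G σ) {x | Approx ε x (effRes G s t)}

/-! ### The two families of graphs -/

/-- The vertices: the sets `S₁` and `S₂`, a source and a sink. -/
abbrev Vert (S₁ S₂ : Type) : Type := (S₁ ⊕ S₂) ⊕ Bool

/-- The source `s`. -/
def src {S₁ S₂ : Type} : Vert S₁ S₂ := .inr false

/-- The sink `t`. -/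
def snk {S₁ S₂ : Type} : Vert S₁ S₂ := .inr true

/-- The graph with the edges of `H` on `S₁`, no edges on `S₂`, the source joined to `N₁ ⊆ S₁` and
`N₂ ⊆ S₂`, and the sink joined to all of `S₁` and `S₂`. -/
def sourceSinkGraph {S₁ S₂ : Type} (H : SimpleGraph S₁) (N₁ : Finset S₁) (N₂ : Finset S₂) :
    SimpleGraph (Vert S₁ S₂) :=
  SimpleGraph.fromRel fun a b =>
    match a, b with
    | .inl (.inl u), .inl (.inl v) => H.Adj u v
    | .inr false, .inl (.inl v) => v ∈ N₁
    | .inr false, .inl (.inr v) => v ∈ N₂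
    | .inr true, .inl _ => True
    | _, _ => False

/-- `x = (1 - ε) d_s`, rounded down. -/
def keep (ε : ℝ) (ds : ℕ) : ℕ := ⌊(1 - ε) * (ds : ℝ)⌋₊

/-- The graphs `G₁`: all `ds` neighbours of the source lie in `S₁`. -/
def Family₁ {S₁ : Type} (S₂ : Type) (H : SimpleGraph S₁) (ds : ℕ) :
    Set (SimpleGraph (Vert S₁ S₂)) :=
  {G | ∃ N₁ : Finset S₁, N₁.card = ds ∧ G = sourceSinkGraph H N₁ ∅}

/-- The graphs `G₂`: `(1 - ε) ds` neighbours of the source lie in `S₁` and the others in `S₂`. -/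
def Family₂ {S₁ : Type} (S₂ : Type) (H : SimpleGraph S₁) (ε : ℝ) (ds : ℕ) :
    Set (SimpleGraph (Vert S₁ S₂)) :=
  {G | ∃ (N₁ : Finset S₁) (N₂ : Finset S₂), N₁.card = keep ε ds ∧ N₂.card = ds - keep ε ds ∧
    G = sourceSinkGraph H N₁ N₂}

open Classical in
/-- The conditions on the parameters. The constant `K` makes `ds ≫ 1/ε` and `n₂ ≪ n₁` precise. -/
structure Admissible {S₁ S₂ : Type} [Fintype S₁] [Fintype S₂] (φ K ε : ℝ)
    (H : SimpleGraph S₁) (d ds : ℕ) : Prop where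
  regular : ∀ v, H.degree v = d
  expander : φ ≤ conductance H
  source_large : K / ε ≤ ds
  source_le : ds ≤ Fintype.card S₂
  small : K * (Fintype.card S₂ : ℝ) ≤ Fintype.card S₁
  degree_large : (ds : ℝ) * Real.log (Fintype.card S₁) ≤ d
  degree_large' : Real.log (Fintype.card S₁) ^ 2 ≤ d
  size_large : 2 * d ^ 3 ≤ Fintype.card S₁

/-- `A` answers `true` on `𝒢₁` and `false` on `𝒢₂`, each with probability at least `2/3`, however
the adjacency lists are ordered. -/
def Distinguishes {V : Type} [Fintype V] [Nonempty V] (𝒢₁ 𝒢₂ : Set (SimpleGraph V))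
    (A : Algo V Bool) : Prop :=
  (∀ G ∈ 𝒢₁, ∀ σ : AdjLists G, 2 / 3 ≤ A.successProb (oracle G σ) {true}) ∧
  (∀ G ∈ 𝒢₂, ∀ σ : AdjLists G, 2 / 3 ≤ A.successProb (oracle G σ) {false})

end ERLower

end

/-! Resistance. In `sourceSinkGraph` every vertex of `S₁` is joined to the sink, and the expander
`H` of large degree `d` almost shorts `S₁` to the sink: at a neighbour of the source in `S₁`, the
rest of the network adds a resistance of only order `1 / d`. Such a neighbour therefore contributes
a conductance close to 1, while a neighbour in `S₂` only gives a path with two edges, of conductance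
1/2. Moving about `ε ds` neighbours from `S₁` to `S₂` lowers the effective conductance from nearly
`ds` to at most `ds (1 - ε / 2)`. A test function bounds the resistance of the second family from
below (`energy_test_le`, `sq_sub_le_effRes_mul_energy`). For the first family an energy bound for
all functions is needed (`le_energy_sourceSinkGraph`). It rests on a Cheeger inequality for
functions of small support (`cheeger`), applied after truncation.

Queries. The `k = ds` positions of the source's adjacency list are fixed, and for each `i` a cyclic
interval of `b ≈ ε k` positions starting at `i` is redirected to `S₂`, with everything else left in
place. One query concerns at most one position, and a position lies in exactly `b` of the `k`
intervals, so a query detects at most `b` of the `k` modified graphs. A hybrid argument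
(`Algo.card_mul_run_le`) turns this into `k ≤ 3 b T` for the expected number `T` of queries, that is
`T ≥ 1 / (6 ε)` (`le_expectedQueries_of_separates`). No probability distribution on graphs is
needed.

Approximation. For small `ε` an `ε`-approximation separates the two families with parameter `16 ε`.
For the other `ε` a constant bound suffices, and it comes from comparing a source of large degree
with a source of degree one. Hamming graphs provide the expanders. -/

namespace ERLower

/-! ### Hybrid argument for query algorithms -/

section Hybrid

open scoped Classical ENNReal

variable {V α ι : Type}

theorem Algo.run_zero (A : Algo V α) (O : Query V → PMF (Answer V)) (m : A.State) :
    A.run O 0 m = (A.next m).bind fun act =>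
      match act with
      | .inl _ => PMF.pure none
      | .inr a => PMF.pure (some a) := rfl

theorem Algo.run_succ (A : Algo V α) (O : Query V → PMF (Answer V)) (k : ℕ) (m : A.State) :
    A.run O (k + 1) m = (A.next m).bind fun act =>
      match act with
      | .inl mq => (O mq.2).bind fun ans => A.run O k (A.receive mq.1 ans)
      | .inr a => PMF.pure (some a) := rfl

theorem toOuterMeasure_le_one {β : Type*} (p : PMF β) (s : Set β) : p.toOuterMeasure s ≤ 1 := by
  rw [PMF.toOuterMeasure_apply, ← p.tsum_coe]
  exact ENNReal.tsum_le_tsum fun x => Set.indicator_le_self _ _ _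

/-- Replacing the oracle `O` by the oracles `O' i` changes the success probability on average by
at most the expected number of queries times the largest number of indices `i` at which the answer
to one query changes. -/
theorem Algo.card_mul_run_le (A : Algo V α) (O : Query V → PMF (Answer V))
    (O' : ι → Query V → PMF (Answer V)) (b : ℕ) (s : Set (Option α))
    (J : Finset ι) (hb : ∀ q, (J.filter fun i => O' i q ≠ O q).card ≤ b) (k : ℕ) :
    ∀ (m : A.State) (I : Finset ι), I ⊆ J →
      (I.card : ℝ≥0∞) * (A.run O k m).toOuterMeasure s ≤
        ∑ i ∈ I, (A.run (O' i) k m).toOuterMeasure s +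
          b * ∑ j ∈ Finset.range k, A.run O j m none := by
  induction k with
  | zero =>
    intro m I _
    simp [Algo.run_zero, Finset.sum_const, nsmul_eq_mul]
  | succ k ih =>
    intro m I hI
    rw [Finset.sum_range_succ', Algo.run_zero]
    simp only [Algo.run_succ, PMF.toOuterMeasure_bind_apply, PMF.bind_apply]
    rw [← ENNReal.tsum_mul_left, ← Summable.tsum_finsetSum (fun _ _ => ENNReal.summable),
      ← Summable.tsum_finsetSum (fun _ _ => ENNReal.summable),
      ← ENNReal.tsum_add, ← ENNReal.tsum_mul_left, ← ENNReal.tsum_add]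
    refine ENNReal.tsum_le_tsum fun act => ?_
    rw [← Finset.mul_sum, ← Finset.mul_sum, ← mul_add, mul_left_comm (I.card : ℝ≥0∞),
      mul_left_comm (b : ℝ≥0∞), ← mul_add]
    refine mul_le_mul_right ?_ _
    rcases act with ⟨m', q⟩ | a
    -- The query `q` is asked. The at most `b` indices whose answer law changes are given up at cost
    -- at most `b`, since `P ≤ 1`; the term `j = 0`, which is 1 on this branch, pays for them. The
    -- other indices form `g` and continue with the same answer law. This is why the induction runs
    -- over all subsets `I` of `J`.
    · have hsub : I.filter (fun i => O' i q ≠ O q) ⊆ J.filter fun i => O' i q ≠ O q :=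
        Finset.filter_subset_filter _ hI
      have hcard : ((I.filter fun i => O' i q ≠ O q).card : ℝ≥0∞) ≤ b := by
        exact_mod_cast (Finset.card_le_card hsub).trans (hb q)
      have hsplit : (I.card : ℝ≥0∞) = (I.filter fun i => O' i q = O q).card +
          (I.filter fun i => O' i q ≠ O q).card := by
        rw [← Nat.cast_add, Finset.card_filter_add_card_filter_not]
      simp only [PMF.toOuterMeasure_bind_apply, PMF.bind_apply, PMF.pure_apply, if_true]
      set P : ℝ≥0∞ := ∑' ans, O q ans * (A.run O k (A.receive m' ans)).toOuterMeasure s with hP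
      have hP1 : P ≤ 1 := by
        rw [← (O q).tsum_coe]
        exact ENNReal.tsum_le_tsum fun ans =>
          (mul_le_mul_right (toOuterMeasure_le_one _ _) _).trans (mul_one _).le
      set g := I.filter fun i => O' i q = O q with hg
      have key : (g.card : ℝ≥0∞) * P ≤
          ∑ i ∈ g, ∑' ans, O' i q ans * (A.run (O' i) k (A.receive m' ans)).toOuterMeasure s +
          b * ∑ j ∈ Finset.range k, ∑' ans, O q ans * A.run O j (A.receive m' ans) none := by
        have h1 : ∑ i ∈ g, ∑' ans, O' i q ans *
            (A.run (O' i) k (A.receive m' ans)).toOuterMeasure s =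
            ∑ i ∈ g, ∑' ans, O q ans *
              (A.run (O' i) k (A.receive m' ans)).toOuterMeasure s :=
          Finset.sum_congr rfl fun i hi => by rw [(Finset.mem_filter.1 hi).2]
        rw [h1, hP, ← ENNReal.tsum_mul_left,
          ← Summable.tsum_finsetSum (fun _ _ => ENNReal.summable),
          ← Summable.tsum_finsetSum (fun _ _ => ENNReal.summable),
          ← ENNReal.tsum_mul_left, ← ENNReal.tsum_add]
        refine ENNReal.tsum_le_tsum fun ans => ?_
        rw [← Finset.mul_sum, ← Finset.mul_sum, mul_left_comm (g.card : ℝ≥0∞),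
          mul_left_comm (b : ℝ≥0∞), ← mul_add]
        refine mul_le_mul_right ?_ _
        exact ih _ g ((Finset.filter_subset _ _).trans hI)
      calc (I.card : ℝ≥0∞) * P = g.card * P + (I.filter fun i => O' i q ≠ O q).card * P := by
            rw [hsplit, add_mul]
        _ ≤ (∑ i ∈ g, ∑' ans, O' i q ans *
              (A.run (O' i) k (A.receive m' ans)).toOuterMeasure s +
            b * ∑ j ∈ Finset.range k, ∑' ans, O q ans * A.run O j (A.receive m' ans) none) +
            b * 1 := by gcongr
        _ ≤ _ := by
            rw [add_assoc, ← mul_add]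
            gcongr
            exact Finset.filter_subset _ _
    · simp [Finset.sum_const, nsmul_eq_mul]

theorem Algo.run_mono (A : Algo V α) (O : Query V → PMF (Answer V)) (s : Set α) (k : ℕ) :
    ∀ m : A.State, (A.run O k m).toOuterMeasure (some '' s) ≤
      (A.run O (k + 1) m).toOuterMeasure (some '' s) := by
  induction k with
  | zero =>
    intro m
    rw [Algo.run_zero, Algo.run_succ]
    simp only [PMF.toOuterMeasure_bind_apply]
    refine ENNReal.tsum_le_tsum fun act => mul_le_mul_right ?_ _
    rcases act with ⟨m', q⟩ | a
    · simp [PMF.toOuterMeasure_pure_apply]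
    · exact le_rfl
  | succ k ih =>
    intro m
    rw [Algo.run_succ, Algo.run_succ A O (k + 1)]
    simp only [PMF.toOuterMeasure_bind_apply]
    refine ENNReal.tsum_le_tsum fun act => mul_le_mul_right ?_ _
    rcases act with ⟨m', q⟩ | a
    · simp only [PMF.toOuterMeasure_bind_apply]
      exact ENNReal.tsum_le_tsum fun ans => mul_le_mul_right (ih _) _
    · exact le_rfl

theorem Algo.successProb_mono (A : Algo V α) (O : Query V → PMF (Answer V)) {s s' : Set α}
    (h : s ⊆ s') : A.successProb O s ≤ A.successProb O s' :=
  iSup_mono fun _ => MeasureTheory.measure_mono (Set.image_mono h)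

theorem Algo.successProb_add_le_one (A : Algo V α) (O : Query V → PMF (Answer V)) {s s' : Set α}
    (h : Disjoint s s') : A.successProb O s + A.successProb O s' ≤ 1 := by
  have hm : ∀ r : Set α, Monotone fun k => (A.run O k A.init).toOuterMeasure (some '' r) :=
    fun r => monotone_nat_of_le_succ fun k => A.run_mono O r k _
  unfold Algo.successProb
  rw [ENNReal.iSup_add_iSup_of_monotone (hm s) (hm s')]
  refine iSup_le fun k => ?_
  have hd : Disjoint (some '' s) (some '' s') :=
    (Set.disjoint_image_iff (Option.some_injective _)).2 h
  rw [PMF.toOuterMeasure_apply, PMF.toOuterMeasure_apply, ← ENNReal.tsum_add,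
    ← (A.run O k A.init).tsum_coe]
  refine ENNReal.tsum_le_tsum fun x => ?_
  rw [← congrFun (Set.indicator_union_of_disjoint hd _) x]
  exact Set.indicator_le_self _ _ _

/-- An algorithm that separates the oracle `O` from each of the oracles `O' i` makes on `O` at least
`|ι| / (3 b)` queries in expectation, if the answer to one query changes for at most `b` of the
indices. -/
theorem Algo.card_le_mul_expectedQueries [Fintype ι] (A : Algo V α)
    (O : Query V → PMF (Answer V)) (O' : ι → Query V → PMF (Answer V)) (b : ℕ)
    (hb : ∀ q, (Finset.univ.filter fun i => O' i q ≠ O q).card ≤ b) {s s' : Set α}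
    (hss : Disjoint s s') (hs : 2 / 3 ≤ A.successProb O s)
    (hs' : ∀ i, 2 / 3 ≤ A.successProb (O' i) s') :
    (Fintype.card ι : ℝ≥0∞) ≤ 3 * b * A.expectedQueries O := by
  have h13 : (2 / 3 + 1 / 3 : ℝ≥0∞) = 1 := by
    rw [ENNReal.div_add_div_same]; norm_num
    exact ENNReal.div_self (by norm_num) (by norm_num)
  have hle : ∀ i, A.successProb (O' i) s ≤ 1 / 3 := by
    intro i
    have h := (add_le_add_left (hs' i) (A.successProb (O' i) s)).trans
      ((add_comm _ _).le.trans (A.successProb_add_le_one (O' i) hss))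
    rw [← h13] at h
    have h23 : (2 / 3 : ℝ≥0∞) ≠ ⊤ := ENNReal.div_ne_top (by norm_num) (by norm_num)
    exact (ENNReal.add_le_add_iff_left h23).1 h
  have hk : ∀ k, (Fintype.card ι : ℝ≥0∞) * (A.run O k A.init).toOuterMeasure (some '' s) ≤
      Fintype.card ι * (1 / 3) + b * A.expectedQueries O := by
    intro k
    have h := A.card_mul_run_le O O' b (some '' s) Finset.univ hb k A.init
      Finset.univ le_rfl
    rw [Finset.card_univ] at h
    refine h.trans (add_le_add ?_ ?_)
    · refine (Finset.sum_le_sum fun i _ => (?_ : _ ≤ (1 / 3 : ℝ≥0∞))).trans ?_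
      · exact (le_iSup (fun k => (A.run (O' i) k A.init).toOuterMeasure (some '' s)) k).trans
          (hle i)
      · simp [Finset.sum_const, nsmul_eq_mul]
    · gcongr
      exact ENNReal.sum_le_tsum _
  have hsup : (Fintype.card ι : ℝ≥0∞) * (2 / 3) ≤
      Fintype.card ι * (1 / 3) + b * A.expectedQueries O := by
    refine (mul_le_mul_right hs _).trans ?_
    rw [Algo.successProb, ENNReal.mul_iSup]
    exact iSup_le hk
  by_cases htop : (b : ℝ≥0∞) * A.expectedQueries O = ⊤
  · rw [mul_assoc, htop]; simp
  · rw [mul_assoc]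
    set X := (b : ℝ≥0∞) * A.expectedQueries O
    lift X to NNReal using htop with x hx
    have e2 : (2 / 3 : ℝ≥0∞) = ((2 / 3 : NNReal) : ℝ≥0∞) := by norm_num [ENNReal.coe_div]
    have e1 : (1 / 3 : ℝ≥0∞) = ((1 / 3 : NNReal) : ℝ≥0∞) := by norm_num [ENNReal.coe_div]
    rw [e2, e1] at hsup
    have h' : (Fintype.card ι : NNReal) * (2 / 3) ≤ Fintype.card ι * (1 / 3) + x := by
      exact_mod_cast hsup
    have h'' : (Fintype.card ι : NNReal) ≤ 3 * x := by
      rw [← NNReal.coe_le_coe] at h' ⊢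
      push_cast at h' ⊢
      linarith
    exact_mod_cast h''

end Hybrid

end ERLower

namespace ERLower

/-! ### Pseudo-inverse, energy and effective resistance -/

section EffectiveResistance

open scoped Classical Matrix

variable {V : Type} [Fintype V]

/-- In an eigenbasis all but the symmetry reduce to `x * x⁻¹ * x = x`, which also holds at `x = 0`
because `0⁻¹ = 0`. -/
theorem pinv_identities (A : Matrix V V ℝ) (hA : A.IsHermitian) :
    A * pinv A hA * A = A ∧ pinv A hA * A * pinv A hA = pinv A hA ∧
      A * A * pinv A hA = A ∧ (pinv A hA)ᵀ = pinv A hA := by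
  set U : Matrix V V ℝ := (hA.eigenvectorUnitary : Matrix V V ℝ) with hU
  set D : Matrix V V ℝ := Matrix.diagonal hA.eigenvalues with hD
  set D' : Matrix V V ℝ := Matrix.diagonal (fun i => (hA.eigenvalues i)⁻¹) with hD'
  have hUU : star U * U = 1 := Unitary.coe_star_mul_self hA.eigenvectorUnitary
  have hspec : A = U * D * star U := by
    have h := hA.spectral_theorem
    rw [Unitary.conjStarAlgAut_apply] at h
    exact h
  have hp : pinv A hA = U * D' * star U := by
    rw [pinv, hU, hD']
  have hmul : ∀ X Y : Matrix V V ℝ, (U * X * star U) * (U * Y * star U) = U * (X * Y) * star U := by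
    intro X Y
    calc (U * X * star U) * (U * Y * star U) = U * X * (star U * U) * Y * star U := by
          simp only [Matrix.mul_assoc]
      _ = _ := by rw [hUU]; simp only [Matrix.mul_assoc, Matrix.one_mul]
  have hi : ∀ x : ℝ, x * x⁻¹ * x = x := fun x => by
    rcases eq_or_ne x 0 with rfl | hx
    · simp
    · field_simp
  have d1 : D * D' * D = D := by
    simp only [hD, hD', Matrix.diagonal_mul_diagonal, hi]
  have d2 : D' * D * D' = D' := by
    simp only [hD, hD', Matrix.diagonal_mul_diagonal]
    congr 1; ext i
    simpa using hi (hA.eigenvalues i)⁻¹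
  have d3 : D * D * D' = D := by
    simp only [hD, hD', Matrix.diagonal_mul_diagonal]
    congr 1; ext i
    rw [mul_assoc, mul_comm, hi]
  rw [hp]
  refine ⟨?_, ?_, ?_, ?_⟩
  · calc A * (U * D' * star U) * A
        = (U * D * star U) * (U * D' * star U) * (U * D * star U) := by rw [← hspec]
      _ = A := by rw [hmul, hmul, d1, ← hspec]
  · calc U * D' * star U * A * (U * D' * star U)
        = (U * D' * star U) * (U * D * star U) * (U * D' * star U) := by rw [← hspec]
      _ = _ := by rw [hmul, hmul, d2]
  · calc A * A * (U * D' * star U)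
        = (U * D * star U) * (U * D * star U) * (U * D' * star U) := by rw [← hspec]
      _ = A := by rw [hmul, hmul, d3, ← hspec]
  · have hs : star U = Uᵀ := by
      rw [Matrix.star_eq_conjTranspose, Matrix.conjTranspose_eq_transpose_of_trivial]
    rw [hs, Matrix.transpose_mul, Matrix.transpose_mul, Matrix.transpose_transpose, hD',
      Matrix.diagonal_transpose, Matrix.mul_assoc]

/-- The Dirichlet energy `∑_{uv ∈ E} (f u - f v)²`. -/
noncomputable def energy (G : SimpleGraph V) (f : V → ℝ) : ℝ :=
  (∑ i, ∑ j, if G.Adj i j then (f i - f j) ^ 2 else 0) / 2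

theorem energy_eq (G : SimpleGraph V) (f : V → ℝ) :
    f ⬝ᵥ (laplacian G).mulVec f = energy G f := by
  rw [laplacian, energy, ← SimpleGraph.lapMatrix_toLinearMap₂', Matrix.toLinearMap₂'_apply']

theorem energy_nonneg (G : SimpleGraph V) (f : V → ℝ) : 0 ≤ energy G f := by
  unfold energy
  positivity

/-- The potential of the unit current from `s` to `t`. -/
noncomputable def potential (G : SimpleGraph V) (s t : V) : V → ℝ :=
  (pinv (laplacian G) (laplacian_isHermitian G)).mulVec (Pi.single s 1 - Pi.single t 1)

theorem effRes_eq_sub (G : SimpleGraph V) (s t : V) :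
    effRes G s t = potential G s t s - potential G s t t := by
  have h : effRes G s t = (Pi.single s 1 - Pi.single t 1 : V → ℝ) ⬝ᵥ potential G s t := rfl
  rw [h, sub_dotProduct, single_dotProduct, single_dotProduct, one_mul, one_mul]

theorem effRes_eq_energy (G : SimpleGraph V) (s t : V) :
    effRes G s t = energy G (potential G s t) := by
  obtain ⟨-, h2, -, h4⟩ := pinv_identities (laplacian G) (laplacian_isHermitian G)
  set P := pinv (laplacian G) (laplacian_isHermitian G) with hP
  have h : effRes G s t = (Pi.single s 1 - Pi.single t 1 : V → ℝ) ⬝ᵥ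
    P.mulVec (Pi.single s 1 - Pi.single t 1) := rfl
  rw [← energy_eq, h, potential, ← hP]
  set b : V → ℝ := Pi.single s 1 - Pi.single t 1
  nth_rewrite 1 [← h2]
  rw [← Matrix.mulVec_mulVec, ← Matrix.mulVec_mulVec, Matrix.dotProduct_mulVec,
    ← Matrix.mulVec_transpose, h4]

theorem effRes_nonneg (G : SimpleGraph V) (s t : V) : 0 ≤ effRes G s t := by
  rw [effRes_eq_energy]; exact energy_nonneg _ _

/-- The potential has both drop and energy equal to the resistance `R`, so the hypothesis gives `C
R² ≤ R`. Connectedness plays no role in this direction. -/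
theorem effRes_le_inv (G : SimpleGraph V) (s t : V) {C : ℝ} (hC : 0 < C)
    (h : ∀ f : V → ℝ, C * (f s - f t) ^ 2 ≤ energy G f) : effRes G s t ≤ 1 / C := by
  have h1 := h (potential G s t)
  rw [← effRes_eq_sub, ← effRes_eq_energy] at h1
  rcases (effRes_nonneg G s t).eq_or_lt with h0 | h0
  · rw [← h0]; positivity
  · rw [le_div_iff₀ hC]
    nlinarith

/-- The defect `w = b - L p` lies in the kernel of `L` because `L L L† = L`, so it is constant on a
connected graph. Both `b` and `L p` are orthogonal to `w`, hence `w` is orthogonal to itself. -/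
theorem laplacian_mulVec_potential (G : SimpleGraph V) (hG : G.Preconnected) (s t : V) :
    (laplacian G).mulVec (potential G s t) = Pi.single s 1 - Pi.single t 1 := by
  obtain ⟨-, -, h3, -⟩ := pinv_identities (laplacian G) (laplacian_isHermitian G)
  set b : V → ℝ := Pi.single s 1 - Pi.single t 1 with hb
  set p := potential G s t with hp
  set w : V → ℝ := b - (laplacian G).mulVec p with hw
  have hker : (laplacian G).mulVec w = 0 := by
    rw [hw, Matrix.mulVec_sub, hp, potential, Matrix.mulVec_mulVec, Matrix.mulVec_mulVec,
      h3, sub_self]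
  have hconst : ∀ i j, w i = w j := fun i j =>
    (SimpleGraph.lapMatrix_mulVec_eq_zero_iff_forall_reachable G).1 hker i j (hG i j)
  have hbw : b ⬝ᵥ w = 0 := by
    rw [hb, sub_dotProduct, single_dotProduct, single_dotProduct, hconst s t, sub_self]
  have hsymm : (laplacian G)ᵀ = laplacian G := SimpleGraph.isSymm_lapMatrix ℝ G
  have hpw : (laplacian G).mulVec p ⬝ᵥ w = 0 := by
    rw [dotProduct_comm, Matrix.dotProduct_mulVec, ← Matrix.mulVec_transpose, hsymm, hker,
      zero_dotProduct]
  have hww : w ⬝ᵥ w = 0 := by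
    nth_rewrite 1 [hw]
    rw [sub_dotProduct, hbw, hpw, sub_zero]
  have hw0 : w = 0 := dotProduct_self_eq_zero.1 hww
  exact (sub_eq_zero.1 hw0).symm

theorem sub_eq_energy_form (G : SimpleGraph V) (hG : G.Preconnected) (s t : V) (f : V → ℝ) :
    f s - f t = f ⬝ᵥ (laplacian G).mulVec (potential G s t) := by
  rw [laplacian_mulVec_potential G hG, dotProduct_sub, dotProduct_single, dotProduct_single,
    mul_one, mul_one]

/-- Thomson's principle in dual form. -/
theorem sq_sub_le_effRes_mul_energy (G : SimpleGraph V) (hG : G.Preconnected) (s t : V)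
    (f : V → ℝ) : (f s - f t) ^ 2 ≤ effRes G s t * energy G f := by
  set p := potential G s t with hp
  set R := effRes G s t
  have hsymm : (laplacian G)ᵀ = laplacian G := SimpleGraph.isSymm_lapMatrix ℝ G
  have hR : R = p ⬝ᵥ (laplacian G).mulVec p := by rw [energy_eq, ← effRes_eq_energy]
  have h1 : f s - f t = f ⬝ᵥ (laplacian G).mulVec p := sub_eq_energy_form G hG s t f
  have h2 : p ⬝ᵥ (laplacian G).mulVec f = f s - f t := by
    rw [h1, Matrix.dotProduct_mulVec, ← Matrix.mulVec_transpose, hsymm, dotProduct_comm]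
  -- The quadratic polynomial in `x` is the energy of `f + x • p`; its discriminant yields
  -- Cauchy-Schwarz for the energy form.
  have hq : ∀ x : ℝ, 0 ≤ R * (x * x) + (2 * (f s - f t)) * x + energy G f := by
    intro x
    have h := energy_nonneg G (f + x • p)
    rw [← energy_eq] at h
    simp only [Matrix.mulVec_add, Matrix.mulVec_smul, dotProduct_add, add_dotProduct,
      dotProduct_smul, smul_dotProduct, smul_eq_mul, energy_eq] at h
    rw [h2, ← h1, ← energy_eq G p, ← hR] at h
    linarith
  have := discrim_le_zero hq
  unfold discrim at this
  nlinarith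

end EffectiveResistance

end ERLower

namespace ERLower

/-! ### Conductance and Cheeger's inequality -/

section Conductance

open scoped Classical

variable {V : Type}

/-- The real-valued indicator function of a vertex set. -/
noncomputable def ind (S : Finset V) (v : V) : ℝ := if v ∈ S then 1 else 0

theorem ind_of_notMem {S : Finset V} {v : V} (h : v ∉ S) : ind S v = 0 := if_neg h

theorem ind_nonneg (S : Finset V) (v : V) : 0 ≤ ind S v := by
  unfold ind; split_ifs <;> norm_num

theorem ind_le_one (S : Finset V) (v : V) : ind S v ≤ 1 := by
  unfold ind; split_ifs <;> norm_num

theorem ind_eq_one_sub {S T : Finset V} (h : ∀ v, v ∈ T ↔ v ∉ S) (v : V) :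
    ind T v = 1 - ind S v := by
  by_cases hv : v ∈ S <;> simp [ind, hv, h]

variable [Fintype V]

theorem sum_ind (S : Finset V) : ∑ v, ind S v = S.card := by
  simp [ind]

theorem cut_eq_sum (G : SimpleGraph V) (S : Finset V) :
    (cut G S : ℝ) = ∑ i, ∑ j, if G.Adj i j then ind S i * (1 - ind S j) else 0 := by
  rw [cut, Finset.card_filter, Fintype.sum_prod_type]
  push_cast
  refine Finset.sum_congr rfl fun i _ => Finset.sum_congr rfl fun j _ => ?_
  by_cases hi : i ∈ S <;> by_cases hj : j ∈ S <;> simp [ind, hi, hj]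

theorem cast_degree (G : SimpleGraph V) (v : V) :
    (G.degree v : ℝ) = ∑ j, if G.Adj v j then (1 : ℝ) else 0 := by
  rw [SimpleGraph.degree_eq_sum_if_adj]

theorem vol_eq_sum (G : SimpleGraph V) (S : Finset V) :
    (vol G S : ℝ) = ∑ i, ∑ j, if G.Adj i j then ind S i else 0 := by
  have h : vol G S = ∑ i, if i ∈ S then G.degree i else 0 := by
    rw [vol, Finset.sum_ite_mem, Finset.univ_inter]
  rw [h]
  push_cast
  refine Finset.sum_congr rfl fun i _ => ?_
  by_cases h : i ∈ S
  · simp only [h, if_true, cast_degree, ind]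
  · simp [h, ind]

theorem cut_compl (G : SimpleGraph V) {S T : Finset V} (h : ∀ v, v ∈ T ↔ v ∉ S) :
    cut G T = cut G S := by
  have h : (cut G T : ℝ) = cut G S := by
    rw [cut_eq_sum, cut_eq_sum, Finset.sum_comm]
    refine Finset.sum_congr rfl fun i _ => Finset.sum_congr rfl fun j _ => ?_
    rw [G.adj_comm]
    simp only [ind_eq_one_sub h, sub_sub_cancel, mul_comm]
  exact_mod_cast h

theorem mul_min_vol_le_cut {G : SimpleGraph V} {φ : ℝ} (h : φ ≤ conductance G) (S : Finset V)
    (hS : S.Nonempty) (hS' : Sᶜ.Nonempty) :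
    φ * min (vol G S : ℝ) (vol G Sᶜ : ℝ) ≤ cut G S := by
  have hb : BddBelow (Set.range fun S : {S : Finset V // S.Nonempty ∧ Sᶜ.Nonempty} =>
      (cut G S.1 : ℝ) / min (vol G S.1 : ℝ) (vol G (S.1)ᶜ : ℝ)) :=
    ⟨0, by rintro _ ⟨S, rfl⟩; positivity⟩
  have h1 : φ ≤ (cut G S : ℝ) / min (vol G S : ℝ) (vol G Sᶜ : ℝ) :=
    h.trans (ciInf_le hb ⟨S, hS, hS'⟩)
  have h0 : (0 : ℝ) ≤ min (vol G S : ℝ) (vol G Sᶜ : ℝ) := by positivity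
  rcases h0.eq_or_lt with h2 | h2
  · rw [← h2, mul_zero]; positivity
  · exact (le_div_iff₀ h2).1 h1

theorem vol_pos {G : SimpleGraph V} (hdeg : ∀ v, 0 < G.degree v) {S : Finset V}
    (hS : S.Nonempty) : 0 < vol G S :=
  Finset.sum_pos (fun v _ => hdeg v) hS

/-- Describing the complement by membership lets `S` and `T` exchange roles later, when the sink
lies in `S`. -/
theorem le_conductance [Nontrivial V] {G : SimpleGraph V} {φ : ℝ} (hdeg : ∀ v, 0 < G.degree v)
    (h : ∀ S T : Finset V, (∀ v, v ∈ T ↔ v ∉ S) →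
      φ * min (vol G S : ℝ) (vol G T : ℝ) ≤ cut G S) : φ ≤ conductance G := by
  obtain ⟨x, y, hxy⟩ := exists_pair_ne V
  have : Nonempty {S : Finset V // S.Nonempty ∧ Sᶜ.Nonempty} :=
    ⟨⟨{x}, ⟨x, by simp⟩, ⟨y, by simpa using hxy.symm⟩⟩⟩
  refine le_ciInf fun S => ?_
  have h0 : (0 : ℝ) < min (vol G S.1 : ℝ) (vol G (S.1)ᶜ : ℝ) :=
    lt_min (by exact_mod_cast vol_pos hdeg S.2.1) (by exact_mod_cast vol_pos hdeg S.2.2)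
  exact (le_div_iff₀ h0).2 (h S.1 _ fun v => Finset.mem_compl)

theorem preconnected_of_conductance_pos {G : SimpleGraph V} (h : 0 < conductance G) :
    G.Preconnected := by
  intro s t
  by_contra hst
  set S : Finset V := Finset.univ.filter fun v => G.Reachable s v with hS
  have hs : S.Nonempty := ⟨s, by simp [hS]⟩
  have ht : Sᶜ.Nonempty := ⟨t, by simpa [hS] using hst⟩
  have hcut : cut G S = 0 := by
    rw [cut, Finset.card_eq_zero, Finset.filter_eq_empty_iff]
    rintro ⟨a, b⟩ - ⟨ha, hb, hab⟩
    simp only [hS, Finset.mem_filter, Finset.mem_univ, true_and] at ha hb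
    exact hb (ha.trans hab.reachable)
  have hb : BddBelow (Set.range fun S : {S : Finset V // S.Nonempty ∧ Sᶜ.Nonempty} =>
      (cut G S.1 : ℝ) / min (vol G S.1 : ℝ) (vol G (S.1)ᶜ : ℝ)) :=
    ⟨0, by rintro _ ⟨S, rfl⟩; positivity⟩
  have h1 := h.trans_le (ciInf_le hb ⟨S, hs, ht⟩)
  simp [hcut] at h1

theorem vol_of_regular {G : SimpleGraph V} {d : ℕ} (hreg : ∀ v, G.degree v = d) (S : Finset V) :
    vol G S = S.card * d := by
  simp [vol, hreg]

theorem mul_card_le_cut {G : SimpleGraph V} {d : ℕ} (hreg : ∀ v, G.degree v = d) {φ : ℝ}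
    (h : φ ≤ conductance G) (S : Finset V) :
    φ * (d * min (S.card : ℝ) (Fintype.card V - S.card)) ≤ cut G S := by
  have hcompl : (Sᶜ.card : ℝ) = Fintype.card V - S.card := by
    rw [Finset.card_compl, Nat.cast_sub (Finset.card_le_univ S)]
  have h0 : (0 : ℝ) ≤ cut G S := by positivity
  rcases S.eq_empty_or_nonempty with rfl | hS
  · simp
  rcases Sᶜ.eq_empty_or_nonempty with hS' | hS'
  · rw [← hcompl, hS']; simp
  have h1 := mul_min_vol_le_cut h S hS hS'
  rw [vol_of_regular hreg, vol_of_regular hreg] at h1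
  push_cast at h1
  rw [← min_mul_of_nonneg _ _ (by positivity : (0 : ℝ) ≤ d), hcompl] at h1
  linarith

/-- The layer-cake argument of Cheeger's inequality. -/
theorem mul_sum_le_sum_adj_posPart {G : SimpleGraph V} {d : ℕ} (hreg : ∀ v, G.degree v = d) {φ : ℝ}
    (hG : φ ≤ conductance G) (n : ℕ) : ∀ h : V → ℝ, (∀ v, 0 ≤ h v) →
    (Finset.univ.filter fun v => 0 < h v).card = n → 2 * n ≤ Fintype.card V →
    φ * d * ∑ v, h v ≤ ∑ i, ∑ j, if G.Adj i j then max (h i - h j) 0 else 0 := by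
  induction n using Nat.strong_induction_on with
  | _ n ih =>
    intro h h0 hn hn2
    set T := Finset.univ.filter fun v => 0 < h v with hT
    rcases T.eq_empty_or_nonempty with hE | hne
    · have hz : ∀ v, h v = 0 := fun v => by
        have : v ∉ T := by rw [hE]; simp
        simp only [hT, Finset.mem_filter, Finset.mem_univ, true_and, not_lt] at this
        exact le_antisymm this (h0 v)
      simp [hz]
    obtain ⟨v₀, hv₀, hmin⟩ := Finset.exists_min_image T h hne
    have hT' : ∀ v, v ∈ T ↔ 0 < h v := fun v => by simp [hT]
    have hTz : ∀ v, v ∉ T → h v = 0 := fun v hv =>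
      le_antisymm (not_lt.1 fun h' => hv ((hT' v).2 h')) (h0 v)
    set m := h v₀ with hm
    have hmpos : 0 < m := (hT' _).1 hv₀
    -- The lowest layer, of height `m` over the support `T`, is peeled off. At least `v₀` leaves the
    -- support, and the cut of `T`, which holds at most half of the vertices, pays for the layer.
    set h' : V → ℝ := fun v => h v - if v ∈ T then m else 0 with hh'
    have h'0 : ∀ v, 0 ≤ h' v := fun v => by
      simp only [hh']
      split_ifs with hv
      · linarith [hmin v hv]
      · simpa using h0 v
    have hsupp : (Finset.univ.filter fun v => 0 < h' v) ⊂ T := by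
      refine (Finset.ssubset_iff_of_subset ?_).2 ⟨v₀, hv₀, by simp [hh', hv₀, hm]⟩
      intro v hv
      simp only [hh', Finset.mem_filter, Finset.mem_univ, true_and] at hv
      by_contra hvT
      rw [if_neg hvT, hTz v hvT] at hv
      simp at hv
    have hcard := Finset.card_lt_card hsupp
    rw [hn] at hcard
    have hrec := ih _ hcard h' h'0 rfl (by omega)
    have hcut := mul_card_le_cut hreg hG T
    rw [hn, min_eq_left (by
      have : (2 * n : ℝ) ≤ Fintype.card V := by exact_mod_cast hn2
      linarith)] at hcut
    have hsum : ∑ v, h v = ∑ v, h' v + m * n := by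
      simp only [hh', Finset.sum_sub_distrib, Finset.sum_ite_mem, Finset.univ_inter,
        Finset.sum_const, hn, nsmul_eq_mul]
      ring
    have hpt : ∀ i j, max (h i - h j) 0 = max (h' i - h' j) 0 +
        m * (ind T i * (1 - ind T j)) := by
      intro i j
      by_cases hi : i ∈ T <;> by_cases hj : j ∈ T
      · simp [hh', hi, hj, ind]
      · have := hmin i hi
        simp only [hh', hi, hj, hTz j hj, if_true, if_false, sub_zero, ind]
        rw [max_eq_left (by linarith), max_eq_left (by linarith)]; ring
      · have := hmin j hj
        simp only [hh', hi, hj, hTz i hi, if_true, if_false, sub_zero, ind]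
        rw [max_eq_right (by linarith), max_eq_right (by linarith)]; simp
      · simp [hh', hi, hj, hTz i hi, hTz j hj, ind]
    have hsplit : (∑ i, ∑ j, if G.Adj i j then max (h i - h j) 0 else 0) =
        (∑ i, ∑ j, if G.Adj i j then max (h' i - h' j) 0 else 0) + m * cut G T := by
      rw [cut_eq_sum, Finset.mul_sum, ← Finset.sum_add_distrib]
      refine Finset.sum_congr rfl fun i _ => ?_
      rw [Finset.mul_sum, ← Finset.sum_add_distrib]
      refine Finset.sum_congr rfl fun j _ => ?_
      by_cases hadj : G.Adj i j
      · simp only [hadj, if_true, hpt i j]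
      · simp only [hadj, if_false, mul_zero, add_zero]
    rw [hsplit, hsum]
    have := mul_le_mul_of_nonneg_left hcut hmpos.le
    nlinarith

theorem sum_adj_left {G : SimpleGraph V} {d : ℕ} (hreg : ∀ v, G.degree v = d) (F : V → ℝ) :
    (∑ i, ∑ j, if G.Adj i j then F i else 0) = d * ∑ v, F v := by
  rw [Finset.mul_sum]
  refine Finset.sum_congr rfl fun i _ => ?_
  rw [← hreg i, cast_degree, Finset.sum_mul]
  exact Finset.sum_congr rfl fun j _ => by split_ifs <;> simp

theorem sum_adj_right {G : SimpleGraph V} {d : ℕ} (hreg : ∀ v, G.degree v = d) (F : V → ℝ) :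
    (∑ i, ∑ j, if G.Adj i j then F j else 0) = d * ∑ v, F v := by
  rw [Finset.sum_comm, ← sum_adj_left hreg]
  exact Finset.sum_congr rfl fun j _ => Finset.sum_congr rfl fun i _ => by rw [G.adj_comm]

/-- Cheeger's inequality for functions supported on at most half of the vertices. -/
theorem cheeger {G : SimpleGraph V} {d : ℕ} (hreg : ∀ v, G.degree v = d) {φ : ℝ}
    (hφ : 0 < φ) (hG : φ ≤ conductance G) (g : V → ℝ) (hg : ∀ v, 0 ≤ g v)
    (hsupp : 2 * (Finset.univ.filter fun v => 0 < g v).card ≤ Fintype.card V) :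
    φ ^ 2 / 8 * d * ∑ v, g v ^ 2 ≤ energy G g := by
  have hfilter : (Finset.univ.filter fun v => 0 < g v ^ 2) =
      Finset.univ.filter fun v => 0 < g v := by
    refine Finset.filter_congr fun v _ => ?_
    exact ⟨fun h => (hg v).lt_of_ne fun h' => by simp [← h'] at h, fun h => by positivity⟩
  have h1 := mul_sum_le_sum_adj_posPart hreg hG _ (fun v => g v ^ 2)
    (fun v => sq_nonneg _) (by rw [hfilter]) hsupp
  -- Weighted AM-GM on `(g i - g j) * (g i + g j)`. The weight is chosen so that the terms in `g i ^
  -- 2` and `g j ^ 2` sum to half of the left-hand side of `h1` and can be absorbed there.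
  have hpt : ∀ i j, max (g i ^ 2 - g j ^ 2) 0 ≤
      2 / φ * (g i - g j) ^ 2 + (φ / 4 * g i ^ 2 + φ / 4 * g j ^ 2) := by
    intro i j
    have e : (2 / φ * (g i - g j) ^ 2 + (φ / 4 * g i ^ 2 + φ / 4 * g j ^ 2)) =
      (g i - g j) ^ 2 * (2 / φ + φ / 8) + φ / 8 * (g i + g j) ^ 2 := by ring
    refine max_le ?_ (by positivity)
    have h2 : 0 ≤ (4 * (g i - g j) - φ * (g i + g j)) ^ 2 / (8 * φ) := by positivity
    have h3 : (4 * (g i - g j) - φ * (g i + g j)) ^ 2 / (8 * φ) =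
        2 / φ * (g i - g j) ^ 2 + φ / 8 * (g i + g j) ^ 2 - (g i ^ 2 - g j ^ 2) := by
      field_simp; ring
    have h4 : 0 ≤ (g i - g j) ^ 2 * (φ / 8) := by positivity
    rw [e]; linarith
  have h2 : (∑ i, ∑ j, if G.Adj i j then max (g i ^ 2 - g j ^ 2) 0 else 0) ≤
      2 / φ * (2 * energy G g) + (φ / 4 * (d * ∑ v, g v ^ 2) + φ / 4 * (d * ∑ v, g v ^ 2)) := by
    rw [← sum_adj_left hreg (fun v => g v ^ 2)]
    nth_rewrite 2 [sum_adj_left hreg (fun v => g v ^ 2)]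
    rw [← sum_adj_right hreg (fun v => g v ^ 2), energy, mul_div_cancel₀ _ (two_ne_zero)]
    simp only [Finset.mul_sum, ← Finset.sum_add_distrib]
    refine Finset.sum_le_sum fun i _ => Finset.sum_le_sum fun j _ => ?_
    split_ifs
    · exact hpt i j
    · simp
  have h3 := h1.trans h2
  have h4 : φ / 2 * d * ∑ v, g v ^ 2 ≤ 4 / φ * energy G g := by
    have : 2 / φ * (2 * energy G g) = 4 / φ * energy G g := by ring
    rw [this] at h3
    linarith
  have h5 := mul_le_mul_of_nonneg_left h4 (by positivity : 0 ≤ φ / 4)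
  have h6 : φ / 4 * (4 / φ * energy G g) = energy G g := by field_simp
  rw [h6] at h5
  linarith

end Conductance

end ERLower

namespace ERLower

/-! ### Conductance and energy of the source-sink graphs -/

section SourceSink

open scoped Classical

variable {S₁ S₂ : Type} [Fintype S₁] [Fintype S₂]

theorem sourceSinkGraph_adj_inl_inl {S₁ S₂ : Type} (H : SimpleGraph S₁) (N₁ : Finset S₁)
    (N₂ : Finset S₂) (u v : S₁) :
    (sourceSinkGraph H N₁ N₂).Adj (.inl (.inl u)) (.inl (.inl v)) ↔ H.Adj u v := by
  simp only [sourceSinkGraph, SimpleGraph.fromRel_adj, H.adj_comm v u, or_self, ne_eq,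
    Sum.inl.injEq]
  exact ⟨fun h => h.2, fun h => ⟨h.ne, h⟩⟩

/-- A sum over the adjacent pairs of `sourceSinkGraph H N₁ N₂`, split by the type of the edge. -/
theorem sum_adj_sourceSinkGraph (H : SimpleGraph S₁) (N₁ : Finset S₁) (N₂ : Finset S₂)
    (F : Vert S₁ S₂ → Vert S₁ S₂ → ℝ) :
    (∑ i, ∑ j, if (sourceSinkGraph H N₁ N₂).Adj i j then F i j else 0) =
      (∑ u, ∑ v, if H.Adj u v then F (.inl (.inl u)) (.inl (.inl v)) else 0) +
      ∑ u ∈ N₁, (F src (.inl (.inl u)) + F (.inl (.inl u)) src) +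
      ∑ w ∈ N₂, (F src (.inl (.inr w)) + F (.inl (.inr w)) src) +
      ∑ u, (F snk (.inl (.inl u)) + F (.inl (.inl u)) snk) +
      ∑ w, (F snk (.inl (.inr w)) + F (.inl (.inr w)) snk) := by
  simp only [Fintype.sum_sum_type, Fintype.sum_bool, sourceSinkGraph_adj_inl_inl]
  simp only [sourceSinkGraph, SimpleGraph.fromRel_adj]
  simp [Finset.sum_add_distrib, src, snk]
  ring

theorem energy_sourceSinkGraph (H : SimpleGraph S₁) (N₁ : Finset S₁) (N₂ : Finset S₂)
    (f : Vert S₁ S₂ → ℝ) :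
    energy (sourceSinkGraph H N₁ N₂) f = energy H (fun u => f (.inl (.inl u))) +
      ∑ u ∈ N₁, (f src - f (.inl (.inl u))) ^ 2 + ∑ w ∈ N₂, (f src - f (.inl (.inr w))) ^ 2 +
      ∑ u, (f (.inl (.inl u)) - f snk) ^ 2 + ∑ w, (f (.inl (.inr w)) - f snk) ^ 2 := by
  have hdouble : ∀ (T : Type) (s : Finset T) (x : ℝ) (y : T → ℝ),
      ∑ u ∈ s, ((x - y u) ^ 2 + (y u - x) ^ 2) = 2 * ∑ u ∈ s, (x - y u) ^ 2 := by
    intro T s x y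
    rw [Finset.mul_sum]
    exact Finset.sum_congr rfl fun u _ => by ring
  have hswap : ∀ (T : Type) (s : Finset T) (x : ℝ) (y : T → ℝ),
      ∑ u ∈ s, (y u - x) ^ 2 = ∑ u ∈ s, (x - y u) ^ 2 := by
    intro T s x y
    exact Finset.sum_congr rfl fun u _ => by ring
  rw [energy, sum_adj_sourceSinkGraph]
  simp only [hdouble, hswap, energy]
  ring

theorem degree_pos_sourceSinkGraph (H : SimpleGraph S₁) {N₁ : Finset S₁} {N₂ : Finset S₂}
    (hN : 0 < N₁.card + N₂.card) (v : Vert S₁ S₂) : 0 < (sourceSinkGraph H N₁ N₂).degree v := by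
  rw [SimpleGraph.degree_pos_iff_exists_adj]
  have hcases : (∃ u, u ∈ N₁) ∨ ∃ w, w ∈ N₂ := by
    rcases N₁.eq_empty_or_nonempty with h | h
    · rw [h, Finset.card_empty, zero_add] at hN
      exact Or.inr (Finset.card_pos.1 hN)
    · exact Or.inl h
  rcases v with (u | w) | (_ | _)
  · exact ⟨snk, by simp [sourceSinkGraph, SimpleGraph.fromRel_adj, snk]⟩
  · exact ⟨snk, by simp [sourceSinkGraph, SimpleGraph.fromRel_adj, snk]⟩
  · rcases hcases with ⟨u, hu⟩ | ⟨w, hw⟩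
    · exact ⟨.inl (.inl u), by simpa [sourceSinkGraph, SimpleGraph.fromRel_adj] using hu⟩
    · exact ⟨.inl (.inr w), by simpa [sourceSinkGraph, SimpleGraph.fromRel_adj] using hw⟩
  · rcases hcases with ⟨u, hu⟩ | ⟨w, hw⟩
    · exact ⟨.inl (.inl u), by simp [sourceSinkGraph, SimpleGraph.fromRel_adj]⟩
    · exact ⟨.inl (.inr w), by simp [sourceSinkGraph, SimpleGraph.fromRel_adj]⟩

theorem vol_sourceSinkGraph {H : SimpleGraph S₁} {d : ℕ} (hreg : ∀ v, H.degree v = d)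
    (N₁ : Finset S₁) (N₂ : Finset S₂) (S : Finset (Vert S₁ S₂)) :
    (vol (sourceSinkGraph H N₁ N₂) S : ℝ) =
      (d + 1) * (∑ u, ind S (.inl (.inl u))) + ∑ w, ind S (.inl (.inr w)) +
      ∑ u ∈ N₁, ind S (.inl (.inl u)) + ∑ w ∈ N₂, ind S (.inl (.inr w)) +
      ind S src * ((N₁.card : ℝ) + N₂.card) +
      ind S snk * ((Fintype.card S₁ : ℝ) + Fintype.card S₂) := by
  rw [vol_eq_sum, sum_adj_sourceSinkGraph, sum_adj_left hreg fun u => ind S (.inl (.inl u))]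
  simp only [Finset.sum_add_distrib, Finset.sum_const, nsmul_eq_mul, Finset.card_univ]
  ring

/-- The conductance bound for a set `S` without the sink and its complement `T`. -/
theorem vol_le_or_vol_compl_le {H : SimpleGraph S₁} {d : ℕ} (hreg : ∀ v, H.degree v = d) {φ : ℝ}
    (hφ : 0 < φ) (hH : φ ≤ conductance H) {N₁ : Finset S₁} {N₂ : Finset S₂}
    (hN : N₁.card + N₂.card ≤ Fintype.card S₂) (hS : Fintype.card S₂ ≤ Fintype.card S₁)
    (S T : Finset (Vert S₁ S₂)) (hT : ∀ v, v ∈ T ↔ v ∉ S) (hsnk : snk ∉ S) :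
    (vol (sourceSinkGraph H N₁ N₂) S : ℝ) ≤ (14 + 1 / φ) * cut (sourceSinkGraph H N₁ N₂) S ∨
    (vol (sourceSinkGraph H N₁ N₂) T : ℝ) ≤ (14 + 1 / φ) * cut (sourceSinkGraph H N₁ N₂) S := by
  set A : Finset S₁ := Finset.univ.filter fun u => Sum.inl (Sum.inl u) ∈ S with hA
  have hindA : ∀ u, ind A u = ind S (.inl (.inl u)) := fun u => by simp [ind, hA]
  set a : ℝ := ∑ u : S₁, ind S (.inl (.inl u)) with ha
  set b : ℝ := ∑ w : S₂, ind S (.inl (.inr w)) with hb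
  set p : ℝ := ∑ u ∈ N₁, ind S (.inl (.inl u)) with hp
  set r : ℝ := ∑ w ∈ N₂, ind S (.inl (.inr w)) with hr
  have hpa : p ≤ a := Finset.sum_le_sum_of_subset_of_nonneg (Finset.subset_univ _)
    fun i _ _ => ind_nonneg _ _
  have hrb : r ≤ b := Finset.sum_le_sum_of_subset_of_nonneg (Finset.subset_univ _)
    fun i _ _ => ind_nonneg _ _
  have hp0 : 0 ≤ p := Finset.sum_nonneg fun i _ => ind_nonneg _ _
  have hr0 : 0 ≤ r := Finset.sum_nonneg fun i _ => ind_nonneg _ _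
  have haA : (A.card : ℝ) = a := by
    rw [← sum_ind]
    exact Finset.sum_congr rfl fun u _ => hindA u
  have hn₁ : a ≤ Fintype.card S₁ := by
    rw [← haA]; exact_mod_cast Finset.card_le_univ A
  have hN' : (N₁.card : ℝ) + N₂.card ≤ Fintype.card S₂ := by exact_mod_cast hN
  have hS' : (Fintype.card S₂ : ℝ) ≤ Fintype.card S₁ := by exact_mod_cast hS
  have hpN : p ≤ N₁.card := by
    rw [hp, Finset.cast_card]
    exact Finset.sum_le_sum fun i _ => ind_le_one _ _
  have hrN : r ≤ N₂.card := by
    rw [hr, Finset.cast_card]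
    exact Finset.sum_le_sum fun i _ => ind_le_one _ _
  have hcut : (cut (sourceSinkGraph H N₁ N₂) S : ℝ) = cut H A + a + b +
      (ind S src * ((N₁.card - p) + (N₂.card - r)) + (1 - ind S src) * (p + r)) := by
    rw [cut_eq_sum, sum_adj_sourceSinkGraph, cut_eq_sum]
    simp only [hindA, ind_of_notMem hsnk, zero_mul, zero_add, sub_zero, mul_one,
      Finset.sum_add_distrib, ← Finset.mul_sum, ← Finset.sum_mul, Finset.sum_sub_distrib,
      Finset.sum_const, nsmul_eq_mul, ← ha, ← hb, ← hp, ← hr]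
    ring
  have hvol := vol_sourceSinkGraph hreg N₁ N₂ S
  have hvolc := vol_sourceSinkGraph hreg N₁ N₂ T
  simp only [ind_eq_one_sub hT, Finset.sum_sub_distrib, Finset.sum_const, nsmul_eq_mul, mul_one,
    Finset.card_univ, ind_of_notMem hsnk, ← ha, ← hb, ← hp, ← hr] at hvol hvolc
  have hiso := mul_card_le_cut hreg hH A
  rw [haA] at hiso
  set c : ℝ := (cut H A : ℝ) with hc
  have hc0 : 0 ≤ c := by positivity
  have hd0 : (0 : ℝ) ≤ d := by positivity
  have hiso' : d * min a (Fintype.card S₁ - a) ≤ 1 / φ * c := by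
    rw [one_div, inv_mul_eq_div, le_div_iff₀ hφ]; linarith
  have hinv : 0 ≤ 1 / φ := by positivity
  set C : ℝ := (cut (sourceSinkGraph H N₁ N₂) S : ℝ) with hC
  have hsrc : ind S src = 0 ∨ ind S src = 1 := by
    unfold ind; split_ifs <;> simp
  have hcC : 1 / φ * c ≤ 1 / φ * C := by
    refine mul_le_mul_of_nonneg_left ?_ hinv
    rcases hsrc with h | h <;> rw [h] at hcut <;> linarith
  -- Expansion of `H` bounds the dominant term of the volume, `d a` or `d (n₁ - a)`, by `c / φ`. If
  -- `S` holds at most half of `S₁`, the rest of its volume is controlled by the edges to the sink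
  -- and at the source. Otherwise `n₁`, `n₂` and `|N₁| + |N₂|` are all at most `2 a`, and `a` is at
  -- most the cut, since these `a` vertices are joined to the sink outside `S`; the constant 14
  -- leaves room for the sum.
  rcases le_total a (Fintype.card S₁ - a) with h | h
  · left
    rw [min_eq_left h] at hiso'
    rw [hvol]
    rcases hsrc with h | h <;> rw [h] at hcut ⊢ <;> linarith
  · right
    rw [min_eq_right h] at hiso'
    rw [hvolc]
    rcases hsrc with h | h <;> rw [h] at hcut ⊢ <;> linarith

theorem le_conductance_sourceSinkGraph {H : SimpleGraph S₁} {d : ℕ} (hreg : ∀ v, H.degree v = d)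
    {φ : ℝ} (hφ : 0 < φ) (hH : φ ≤ conductance H) {N₁ : Finset S₁} {N₂ : Finset S₂}
    (hN0 : 0 < N₁.card + N₂.card) (hN : N₁.card + N₂.card ≤ Fintype.card S₂)
    (hS : Fintype.card S₂ ≤ Fintype.card S₁) :
    1 / (14 + 1 / φ) ≤ conductance (sourceSinkGraph H N₁ N₂) := by
  have : Nontrivial (Vert S₁ S₂) := ⟨src, snk, by simp [src, snk]⟩
  have hM : 0 < 14 + 1 / φ := by positivity
  refine le_conductance (fun v => ?_) fun S T hT => ?_
  · convert degree_pos_sourceSinkGraph H hN0 v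
  rw [one_div, inv_mul_eq_div, div_le_iff₀ hM, mul_comm]
  by_cases hs : snk ∈ S
  · have h := vol_le_or_vol_compl_le hreg hφ hH hN hS T S (fun v => by rw [hT, not_not])
      fun h => (hT _).1 h hs
    rw [cut_compl _ hT] at h
    exact h.elim (fun h => (min_le_right _ _).trans h) fun h => (min_le_left _ _).trans h
  · exact (vol_le_or_vol_compl_le hreg hφ hH hN hS S T hT hs).elim
      (fun h => (min_le_left _ _).trans h) fun h => (min_le_right _ _).trans h

/-- The conductance between source and sink is at most the number of edges at the source, where a
path through `S₂` counts one half. -/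
theorem energy_test_le (H : SimpleGraph S₁) (N₁ : Finset S₁) (N₂ : Finset S₂) :
    ∃ f : Vert S₁ S₂ → ℝ, f src - f snk = 1 ∧
      energy (sourceSinkGraph H N₁ N₂) f = N₁.card + N₂.card / 2 := by
  -- Potential 1/2 at the midpoint of a path through `N₂` makes its two edges cost 1/4 each. All of
  -- `S₁` is put at the sink's potential, so `H` costs nothing.
  refine ⟨Sum.elim (Sum.elim (fun _ => 0) fun w => if w ∈ N₂ then (1 / 2 : ℝ) else 0)
    fun b => if b then 0 else 1, by simp [src, snk], ?_⟩
  have h1 : ∑ w ∈ N₂, ((1 : ℝ) - if w ∈ N₂ then (1 / 2 : ℝ) else 0) ^ 2 = (N₂.card : ℝ) * (1 / 4) := by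
    rw [← nsmul_eq_mul, ← Finset.sum_const]
    exact Finset.sum_congr rfl fun w hw => by rw [if_pos hw]; norm_num
  have h2 : ∑ w, (if w ∈ N₂ then (1 / 2 : ℝ) else 0) ^ 2 = (N₂.card : ℝ) * (1 / 4) := by
    rw [← nsmul_eq_mul, ← Finset.sum_const, ← Finset.univ_inter N₂, ← Finset.sum_ite_mem,
      Finset.univ_inter]
    exact Finset.sum_congr rfl fun w _ => by split_ifs <;> norm_num
  have h0 : energy H (fun _ => 0) = 0 := by simp [energy]
  rw [energy_sourceSinkGraph]
  simp only [src, snk, Sum.elim_inl, Sum.elim_inr, h0, Bool.false_eq_true, if_false, if_true,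
    sub_zero, h1, h2]
  simp
  ring

/-- The map `x ↦ max (x - θ) 0` is 1-Lipschitz. -/
theorem energy_truncate_le (G : SimpleGraph S₁) (f : S₁ → ℝ) (θ : ℝ) :
    energy G (fun v => max (f v - θ) 0) ≤ energy G f := by
  unfold energy
  gcongr with i _ j _
  split_ifs
  · rw [sq_le_sq]
    have h := abs_max_sub_max_le_abs (f i - θ) (f j - θ) 0
    simpa using h
  · exact le_rfl

/-- To save energy on the edges at the source, `h` must be large on `N₁`. But `h` is large on few
vertices only, or else the edges to the sink alone cost `ds`; and a function of small support is
expensive on the expander `H`. -/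
theorem le_energy_sourceSinkGraph {H : SimpleGraph S₁} {d ds : ℕ} (hreg : ∀ v, H.degree v = d)
    {φ : ℝ} (hφ : 0 < φ) (hH : φ ≤ conductance H) (hd : 0 < d) (hds : ds ≤ d)
    (hn : 2 * d ^ 3 ≤ Fintype.card S₁) {N₁ : Finset S₁} (hN : N₁.card = ds)
    (f : Vert S₁ S₂ → ℝ) (hs : f src = 1) (ht : f snk = 0) :
    ds * (1 - 2 / d - 8 / (d * φ ^ 2)) ≤ energy (sourceSinkGraph H N₁ (∅ : Finset S₂)) f := by
  set h : S₁ → ℝ := fun u => f (.inl (.inl u)) with hh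
  have hd' : (0 : ℝ) < d := by exact_mod_cast hd
  have hds0 : (0 : ℝ) ≤ ds := by positivity
  have hE : energy H h + ∑ u ∈ N₁, (1 - h u) ^ 2 + ∑ u, h u ^ 2 ≤
      energy (sourceSinkGraph H N₁ (∅ : Finset S₂)) f := by
    rw [energy_sourceSinkGraph, hs, ht]
    have : 0 ≤ ∑ w : S₂, (f (.inl (.inr w)) - 0) ^ 2 := by positivity
    simp only [sub_zero, Finset.sum_empty, add_zero] at this ⊢
    linarith
  refine le_trans ?_ hE
  have hE0 := energy_nonneg H h
  have hX0 : 0 ≤ ∑ u ∈ N₁, (1 - h u) ^ 2 := by positivity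
  have hloss : 0 ≤ (ds : ℝ) * (2 / d + 8 / (d * φ ^ 2)) := by positivity
  rcases le_or_gt (ds : ℝ) (∑ u, h u ^ 2) with hbig | hsmall
  · linarith
  set θ : ℝ := 1 / d with hθ
  have hθ0 : 0 < θ := by positivity
  set g : S₁ → ℝ := fun v => max (h v - θ) 0 with hg
  -- Chebyshev: `h` exceeds `1 / d` on at most `ds * d ^ 2 ≤ d ^ 3` vertices, which is at most half
  -- of `S₁` by `hn`.
  have hsupp : 2 * (Finset.univ.filter fun v => 0 < g v).card ≤ Fintype.card S₁ := by
    have h1 : ((Finset.univ.filter fun v => 0 < g v).card : ℝ) * θ ^ 2 ≤ ∑ u, h u ^ 2 := by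
      rw [← nsmul_eq_mul, ← Finset.sum_const]
      refine (Finset.sum_le_sum fun v hv => ?_).trans
        (Finset.sum_le_sum_of_subset_of_nonneg (Finset.subset_univ _) fun v _ _ => sq_nonneg _)
      have hv' : 0 < h v - θ := by
        simpa [hg] using (Finset.mem_filter.1 hv).2
      exact pow_le_pow_left₀ hθ0.le (by linarith) 2
    have h2 : ((Finset.univ.filter fun v => 0 < g v).card : ℝ) ≤ d ^ 3 := by
      have h3 := h1.trans hsmall.le
      rw [hθ, div_pow, one_pow, mul_one_div, div_le_iff₀ (by positivity)] at h3
      have : (ds : ℝ) ≤ d := by exact_mod_cast hds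
      nlinarith [sq_nonneg (d : ℝ)]
    have h3 : (Finset.univ.filter fun v => 0 < g v).card ≤ d ^ 3 := by exact_mod_cast h2
    omega
  have hche := cheeger hreg hφ hH g (fun v => le_max_right _ _) hsupp
  have hEg := energy_truncate_le H h θ
  set l : ℝ := φ ^ 2 / 8 * d with hl
  have hl0 : 0 < l := by positivity
  have hg2 : ∑ u ∈ N₁, g u ^ 2 ≤ ∑ u, g u ^ 2 :=
    Finset.sum_le_sum_of_subset_of_nonneg (Finset.subset_univ _) fun v _ _ => sq_nonneg _
  -- Pointwise, `(1 - h)² ≥ 1 - 2 h ≥ 1 - 2 θ - 2 g`, and `2 g ≤ l g² + 1 / l`. The terms `l g²` are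
  -- paid by the energy of `H`; `1 / l` is the loss `8 / (d φ²)`.
  have hpt : ∑ u ∈ N₁, (1 - 2 * θ - 1 / l - l * g u ^ 2) ≤ ∑ u ∈ N₁, (1 - h u) ^ 2 := by
    refine Finset.sum_le_sum fun u _ => ?_
    have h1 : h u ≤ θ + g u := by linarith [le_max_left (h u - θ) 0]
    have h2 : 0 ≤ (l * g u - 1) ^ 2 / l := by positivity
    have h3 : (l * g u - 1) ^ 2 / l = l * g u ^ 2 - 2 * g u + 1 / l := by
      field_simp; ring
    nlinarith [sq_nonneg (h u)]
  rw [Finset.sum_sub_distrib, ← Finset.mul_sum, Finset.sum_const, hN, nsmul_eq_mul] at hpt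
  have h5 : l * ∑ u ∈ N₁, g u ^ 2 ≤ energy H h :=
    (mul_le_mul_of_nonneg_left hg2 hl0.le).trans (hche.trans hEg)
  have h6 : (1 - 2 / d - 8 / (d * φ ^ 2) : ℝ) = 1 - 2 * θ - 1 / l := by
    rw [hθ, hl]; field_simp
  rw [h6]
  have : 0 ≤ ∑ u, h u ^ 2 := by positivity
  linarith

end SourceSink

end ERLower

namespace ERLower

/-! ### The resistance gap between the two families -/

section ResistanceGap

open scoped Classical

theorem effRes_le_inv_of_normalized {V : Type} [Fintype V] (G : SimpleGraph V) (s t : V) {C : ℝ}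
    (hC : 0 < C) (h : ∀ f : V → ℝ, f s = 1 → f t = 0 → C ≤ energy G f) :
    effRes G s t ≤ 1 / C := by
  refine effRes_le_inv G s t hC fun f => ?_
  rcases eq_or_ne (f s - f t) 0 with h0 | h0
  · rw [h0]; simpa using energy_nonneg G f
  · have h1 := h (fun v => (f v - f t) / (f s - f t)) (div_self h0) (by simp)
    have h2 : energy G (fun v => (f v - f t) / (f s - f t)) = energy G f / (f s - f t) ^ 2 := by
      unfold energy
      rw [div_right_comm]
      congr 1
      rw [Finset.sum_div]
      refine Finset.sum_congr rfl fun i _ => ?_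
      rw [Finset.sum_div]
      refine Finset.sum_congr rfl fun j _ => ?_
      split_ifs
      · rw [← sub_div, div_pow, sub_sub_sub_cancel_right]
      · simp
    rw [h2, le_div_iff₀ (by positivity)] at h1
    exact h1

variable {S₁ S₂ : Type} [Fintype S₁] [Fintype S₂]

theorem one_div_le_effRes_sourceSinkGraph (H : SimpleGraph S₁) {N₁ : Finset S₁} {N₂ : Finset S₂}
    (hN0 : 0 < N₁.card + N₂.card) (hcond : 0 < conductance (sourceSinkGraph H N₁ N₂)) :
    1 / (N₁.card + N₂.card / 2 : ℝ) ≤ effRes (sourceSinkGraph H N₁ N₂) src snk := by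
  obtain ⟨f, hf, hE⟩ := energy_test_le H N₁ N₂
  have h := sq_sub_le_effRes_mul_energy _ (preconnected_of_conductance_pos hcond) src snk f
  rw [hf, hE, one_pow] at h
  have h0 : (0 : ℝ) < N₁.card + N₂.card := by exact_mod_cast hN0
  have h1 : (0 : ℝ) ≤ N₁.card := by positivity
  exact (div_le_iff₀ (by linarith)).2 h

/-- The consequences of admissibility that the proofs use. -/
structure ParameterBounds (φ ε : ℝ) (n₁ n₂ d ds : ℕ) : Prop where
  ds_pos : 0 < ds
  one_le : 1 ≤ ε * ds
  ds_le : ds ≤ n₂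
  card_le : n₂ ≤ n₁
  ds_le_d : ds ≤ d
  loss : (2 / d + 8 / (d * φ ^ 2) : ℝ) ≤ ε / 8
  cube : 2 * d ^ 3 ≤ n₁

theorem Admissible.parameterBounds {φ K ε : ℝ} {H : SimpleGraph S₁} {d ds : ℕ}
    (h : Admissible (S₂ := S₂) φ K ε H d ds) (hφ : 0 < φ) (hε : 0 < ε)
    (hK : 16 + 64 / φ ^ 2 ≤ K) :
    ParameterBounds φ ε (Fintype.card S₁) (Fintype.card S₂) d ds := by
  have hK' : 0 ≤ 64 / φ ^ 2 := by positivity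
  have hKε : 0 < K / ε := div_pos (by linarith) hε
  have hds : 0 < ds := by exact_mod_cast hKε.trans_le h.source_large
  have hKd : K ≤ ε * ds := by
    have := (div_le_iff₀ hε).1 h.source_large
    linarith
  have h2 : (1 : ℝ) ≤ Fintype.card S₂ := by
    exact_mod_cast (Nat.succ_le_of_lt hds).trans h.source_le
  have h21 : (Fintype.card S₂ : ℝ) ≤ Fintype.card S₁ := by nlinarith [h.small]
  have h1 : (16 : ℝ) ≤ Fintype.card S₁ := by nlinarith [h.small]
  -- From `K ≥ 16` and `n₂ ≥ 1` one gets `n₁ ≥ 16 > e`, so the logarithm in `degree_large` can be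
  -- dropped to give `ds ≤ d`.
  have hlog : 1 ≤ Real.log (Fintype.card S₁) := by
    rw [Real.le_log_iff_exp_le (by linarith)]
    linarith [Real.exp_one_lt_d9]
  have hdsd : (ds : ℝ) ≤ d := by
    have : (0 : ℝ) ≤ ds := by positivity
    nlinarith [h.degree_large]
  have hd0 : (0 : ℝ) < d := lt_of_lt_of_le (by exact_mod_cast hds) hdsd
  refine ⟨hds, by linarith, h.source_le, by exact_mod_cast h21, by exact_mod_cast hdsd, ?_,
    h.size_large⟩
  -- The lower bound on `K` is chosen for this loss: `16 + 64 / φ ^ 2 ≤ K ≤ ε * ds ≤ ε * d`.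
  have e : (2 / d + 8 / (d * φ ^ 2) : ℝ) = (16 + 64 / φ ^ 2) / 8 / d := by
    field_simp; ring
  rw [e, div_le_iff₀ hd0]
  nlinarith

theorem keep_le {ε : ℝ} (hε : ε < 1) (ds : ℕ) : (keep ε ds : ℝ) ≤ (1 - ε) * ds :=
  Nat.floor_le (mul_nonneg (by linarith) (by positivity))

theorem keep_le_self {ε : ℝ} (hε : 0 < ε) (hε1 : ε < 1) (ds : ℕ) : keep ε ds ≤ ds := by
  have h := keep_le hε1 ds
  have h0 : (0 : ℝ) ≤ ds := by positivity
  have : (keep ε ds : ℝ) ≤ ds := by nlinarith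
  exact_mod_cast this

namespace ParameterBounds

variable {φ ε : ℝ} {H : SimpleGraph S₁} {d ds : ℕ}

theorem exists_card_eq (h : ParameterBounds φ ε (Fintype.card S₁) (Fintype.card S₂) d ds) :
    ∃ N₁ : Finset S₁, N₁.card = ds := by
  obtain ⟨N₁, -, hN⟩ := Finset.exists_subset_card_eq
    (s := (Finset.univ : Finset S₁)) (n := ds) (h.ds_le.trans h.card_le)
  exact ⟨N₁, hN⟩

theorem conductance_family₁ (h : ParameterBounds φ ε (Fintype.card S₁) (Fintype.card S₂) d ds)
    (hreg : ∀ v, H.degree v = d) (hφ : 0 < φ) (hH : φ ≤ conductance H) {N₁ : Finset S₁}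
    (hN0 : 0 < N₁.card) (hN : N₁.card ≤ ds) :
    1 / (14 + 1 / φ) ≤ conductance (sourceSinkGraph H N₁ (∅ : Finset S₂)) :=
  le_conductance_sourceSinkGraph hreg hφ hH (by simpa using hN0)
    (by simpa using hN.trans h.ds_le) h.card_le

theorem conductance_family₂ (h : ParameterBounds φ ε (Fintype.card S₁) (Fintype.card S₂) d ds)
    (hreg : ∀ v, H.degree v = d) (hφ : 0 < φ) (hH : φ ≤ conductance H) (hε : 0 < ε) (hε1 : ε < 1)
    {G : SimpleGraph (Vert S₁ S₂)} (hG : G ∈ Family₂ S₂ H ε ds) :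
    1 / (14 + 1 / φ) ≤ conductance G := by
  obtain ⟨N₁, N₂, h1, h2, rfl⟩ := hG
  have hk := keep_le_self hε hε1 ds
  have := h.ds_pos
  have := h.ds_le
  exact le_conductance_sourceSinkGraph hreg hφ hH (by omega) (by omega) h.card_le

theorem effRes_family₁_le (h : ParameterBounds φ ε (Fintype.card S₁) (Fintype.card S₂) d ds)
    (hreg : ∀ v, H.degree v = d) (hφ : 0 < φ) (hH : φ ≤ conductance H) (hε1 : ε < 1)
    {N₁ : Finset S₁} (hN : N₁.card = ds) :
    effRes (sourceSinkGraph H N₁ (∅ : Finset S₂)) src snk ≤ 1 / (ds * (1 - ε / 8)) := by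
  have hds : (0 : ℝ) < ds := by exact_mod_cast h.ds_pos
  refine effRes_le_inv_of_normalized _ _ _ (mul_pos hds (by linarith)) fun f hs ht => ?_
  refine le_trans ?_ (le_energy_sourceSinkGraph hreg hφ hH (h.ds_pos.trans_le h.ds_le_d) h.ds_le_d
    h.cube hN f hs ht)
  have := h.loss
  exact mul_le_mul_of_nonneg_left (by linarith) hds.le

/-- The resistances are at most `1 / (ds (1 - ε / 8))` and at least `1 / (ds (1 - ε / 2))`, and `(1
+ ε / 4) (1 - ε / 2) < 1 - ε / 8`. Rounding in `keep` is harmless here, since rounding down only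
raises the second resistance. -/
theorem effRes_gap (h : ParameterBounds φ ε (Fintype.card S₁) (Fintype.card S₂) d ds)
    (hreg : ∀ v, H.degree v = d) (hφ : 0 < φ) (hH : φ ≤ conductance H) (hε : 0 < ε) (hε1 : ε < 1)
    {N₁ : Finset S₁} (hN : N₁.card = ds) {G : SimpleGraph (Vert S₁ S₂)}
    (hG : G ∈ Family₂ S₂ H ε ds) :
    (1 + ε / 4) * effRes (sourceSinkGraph H N₁ (∅ : Finset S₂)) src snk < effRes G src snk := by
  have hcond : 0 < conductance G :=
    lt_of_lt_of_le (by positivity) (h.conductance_family₂ hreg hφ hH hε hε1 hG)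
  obtain ⟨M₁, M₂, h1, h2, rfl⟩ := hG
  have hk := keep_le_self hε hε1 ds
  have hk' := keep_le hε1 ds
  have hds : (0 : ℝ) < ds := by exact_mod_cast h.ds_pos
  have hds' := h.ds_pos
  have hr1 := h.effRes_family₁_le (S₂ := S₂) hreg hφ hH hε1 hN
  have hr2 := one_div_le_effRes_sourceSinkGraph H (N₁ := M₁) (N₂ := M₂) (by omega) hcond
  rw [h1, h2, Nat.cast_sub hk] at hr2
  have hx0 : (0 : ℝ) ≤ keep ε ds := by positivity
  refine lt_of_le_of_lt (mul_le_mul_of_nonneg_left hr1 (by linarith)) (lt_of_lt_of_le ?_ hr2)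
  have hpos : (0 : ℝ) < keep ε ds + (ds - keep ε ds) / 2 := by linarith
  rw [mul_one_div, div_lt_div_iff₀ (mul_pos hds (by linarith)) hpos]
  have hle : (keep ε ds + (ds - keep ε ds) / 2 : ℝ) ≤ ds * (1 - ε / 2) := by linarith
  have : (1 + ε / 4) * (keep ε ds + (ds - keep ε ds) / 2 : ℝ) ≤
      (1 + ε / 4) * (ds * (1 - ε / 2)) := mul_le_mul_of_nonneg_left hle (by linarith)
  nlinarith [mul_pos hds hε, mul_pos (mul_pos hds hε) hε]

end ParameterBounds

end ResistanceGap

end ERLower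

namespace ERLower

/-! ### Swapping neighbours of the source and the query bound -/

section Swap

open scoped Classical

/-- The `i`-th entry of the adjacency list of `v`. -/
noncomputable def listEntry {V : Type} [Fintype V] {G : SimpleGraph V} (σ : AdjLists G) (v : V)
    (i : ℕ) : Option V :=
  if h : i < G.degree v then some (σ v ⟨i, h⟩ : V) else none

theorem listEntry_of_lt {V : Type} [Fintype V] {G : SimpleGraph V} (σ : AdjLists G) {v : V} {i : ℕ}
    (h : i < G.degree v) : listEntry σ v i = some (σ v ⟨i, h⟩ : V) := dif_pos h

theorem listEntry_of_not_lt {V : Type} [Fintype V] {G : SimpleGraph V} (σ : AdjLists G) {v : V}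
    {i : ℕ} (h : ¬ i < G.degree v) : listEntry σ v i = none := dif_neg h

theorem exists_adjLists {V : Type} [Fintype V] {G : SimpleGraph V}
    {P : ∀ v, (Fin (G.degree v) ≃ G.neighborSet v) → Prop} (h : ∀ v, ∃ e, P v e) :
    ∃ σ : AdjLists G, ∀ v, P v (σ v) :=
  Classical.skolem.1 h

theorem exists_ordering {V : Type} [Fintype V] (G : SimpleGraph V) (v : V) {k : ℕ} (h : Fin k → V)
    (hinj : Function.Injective h) (hrange : ∀ x, x ∈ Set.range h ↔ G.Adj v x) :
    G.degree v = k ∧ ∃ e : Fin (G.degree v) ≃ G.neighborSet v,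
      ∀ (i : Fin (G.degree v)) (j : Fin k), (i : ℕ) = j → (e i : V) = h j := by
  set e₀ : Fin k ≃ G.neighborSet v := Equiv.ofBijective
    (fun j => ⟨h j, (hrange _).1 ⟨j, rfl⟩⟩)
    ⟨fun a b hab => hinj (congrArg Subtype.val hab), fun ⟨x, hx⟩ => by
      obtain ⟨j, hj⟩ := (hrange x).2 hx
      exact ⟨j, Subtype.ext hj⟩⟩ with he₀
  have hk : G.degree v = k := by
    rw [← SimpleGraph.card_neighborSet_eq_degree, ← Fintype.card_congr e₀, Fintype.card_fin]
  refine ⟨hk, (finCongr hk).trans e₀, fun i j hij => ?_⟩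
  have : finCongr hk i = j := Fin.ext (by simpa using hij)
  rw [Equiv.trans_apply, this]
  rfl

variable {S₁ S₂ : Type} [Fintype S₁] [Fintype S₂]

/-- The vertices whose adjacency lists change when the neighbours `p j`, `j ∈ J`, of the source are
replaced by `g j`. -/
def Touched {k : ℕ} (p : Fin k → S₁) (g : Fin k → S₂) (J : Finset (Fin k)) (v : Vert S₁ S₂) :
    Prop :=
  ∃ j ∈ J, v = .inl (.inl (p j)) ∨ v = .inl (.inr (g j))

/-- The redirected edges keep their positions in the source's list, so its degree and its other
entries are unchanged. The sink is joined to all of `S₁` and `S₂` in both graphs and sees no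
difference. Lists of touched vertices may be ordered arbitrarily, because a query there is counted
as a detection anyway. -/
theorem exists_swapped_adjLists (H : SimpleGraph S₁) {k : ℕ} (p : Fin k → S₁) (g : Fin k → S₂)
    (hp : Function.Injective p) (hg : Function.Injective g)
    {G : SimpleGraph (Vert S₁ S₂)}
    (hG : G = sourceSinkGraph H (Finset.univ.image p) (∅ : Finset S₂)) (σ : AdjLists G)
    (hσ : ∀ j : Fin k, listEntry σ src j = some (.inl (.inl (p j))))
    (hdeg : G.degree src = k)
    (J : Finset (Fin k)) :
    ∃ σ' : AdjLists (sourceSinkGraph H (Jᶜ.image p) (J.image g)),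
      (sourceSinkGraph H (Jᶜ.image p) (J.image g)).degree src = k ∧
      (∀ i, (∀ j ∈ J, (j : ℕ) ≠ i) → listEntry σ' src i = listEntry σ src i) ∧
      ∀ v, v ≠ src → ¬ Touched p g J v →
        (sourceSinkGraph H (Jᶜ.image p) (J.image g)).degree v = G.degree v ∧
        ∀ i, listEntry σ' v i = listEntry σ v i := by
  set G' := sourceSinkGraph H (Jᶜ.image p) (J.image g) with hG'
  set h : Fin k → Vert S₁ S₂ := fun j => .inl (if j ∈ J then .inr (g j) else .inl (p j)) with hh
  have hinj : Function.Injective h := by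
    intro a b hab
    simp only [hh, Sum.inl.injEq] at hab
    split_ifs at hab
    · exact hg (Sum.inr_injective hab)
    · exact hp (Sum.inl_injective hab)
  have hrange : ∀ x, x ∈ Set.range h ↔ G'.Adj src x := by
    rintro ((u | w) | (_ | _))
    · simp only [hG', src, sourceSinkGraph, SimpleGraph.fromRel_adj, Set.mem_range, hh]
      simp only [ne_eq, reduceCtorEq, not_false_eq_true, or_false, true_and, Finset.mem_image,
        Finset.mem_compl, Sum.inl.injEq]
      constructor
      · rintro ⟨j, hj⟩
        split_ifs at hj with hJ
        exact ⟨j, hJ, Sum.inl_injective hj⟩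
      · rintro ⟨j, hJ, hj⟩
        exact ⟨j, by rw [if_neg hJ, hj]⟩
    · simp only [hG', src, sourceSinkGraph, SimpleGraph.fromRel_adj, Set.mem_range, hh]
      simp only [ne_eq, reduceCtorEq, not_false_eq_true, or_false, true_and, Finset.mem_image,
        Sum.inl.injEq]
      constructor
      · rintro ⟨j, hj⟩
        split_ifs at hj with hJ
        exact ⟨j, hJ, Sum.inr_injective hj⟩
      · rintro ⟨j, hJ, hj⟩
        exact ⟨j, by rw [if_pos hJ, hj]⟩
    · simp [hG', src, sourceSinkGraph, hh]
    · simp [hG', src, sourceSinkGraph, SimpleGraph.fromRel_adj, hh]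
  have hadj : ∀ v, v ≠ src → ¬ Touched p g J v → ∀ x, G'.Adj v x ↔ G.Adj v x := by
    intro v hv ht x
    rcases v with (u | w) | (_ | _)
    · have hu : u ∈ Jᶜ.image p ↔ u ∈ Finset.univ.image p := by
        simp only [Finset.mem_image, Finset.mem_compl, Finset.mem_univ, true_and]
        constructor
        · rintro ⟨j, -, hj⟩; exact ⟨j, hj⟩
        · rintro ⟨j, hj⟩
          exact ⟨j, fun hJ => ht ⟨j, hJ, Or.inl (by rw [hj])⟩, hj⟩
      rcases x with (_ | _) | (_ | _) <;>
        simp only [hG, hG', sourceSinkGraph, SimpleGraph.fromRel_adj, hu]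
    · have hw : w ∈ J.image g ↔ w ∈ (∅ : Finset S₂) := by
        simp only [Finset.mem_image, Finset.notMem_empty, iff_false]
        rintro ⟨j, hJ, hj⟩
        exact ht ⟨j, hJ, Or.inr (by rw [hj])⟩
      rcases x with (_ | _) | (_ | _) <;>
        simp only [hG, hG', sourceSinkGraph, SimpleGraph.fromRel_adj, hw]
    · exact absurd rfl hv
    · rcases x with (_ | _) | (_ | _) <;>
        simp only [hG, hG', sourceSinkGraph, SimpleGraph.fromRel_adj]
  have hex : ∀ v, ∃ e : Fin (G'.degree v) ≃ G'.neighborSet v,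
      (v = src → ∀ (i : Fin (G'.degree v)) (j : Fin k), (i : ℕ) = j → (e i : Vert S₁ S₂) = h j) ∧
      (v ≠ src → ¬ Touched p g J v → G'.degree v = G.degree v ∧
        ∀ (i : Fin (G'.degree v)) (j : Fin (G.degree v)), (i : ℕ) = j →
          (e i : Vert S₁ S₂) = σ v j) := by
    intro v
    by_cases hv : v = src
    · subst hv
      obtain ⟨-, e, he⟩ := exists_ordering G' src h hinj hrange
      exact ⟨e, fun _ => he, fun h => absurd rfl h⟩
    by_cases ht : Touched p g J v
    · exact ⟨Fintype.equivOfCardEq (by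
        rw [SimpleGraph.card_neighborSet_eq_degree, Fintype.card_fin]),
        fun h => absurd h hv, fun _ h => absurd ht h⟩
    · obtain ⟨hd, e, he⟩ := exists_ordering G' v (fun i => (σ v i : Vert S₁ S₂))
        (fun a b hab => (σ v).injective (Subtype.ext hab)) (fun x => by
          rw [hadj v hv ht]
          constructor
          · rintro ⟨j, rfl⟩; exact (σ v j).2
          · intro hx; exact ⟨(σ v).symm ⟨x, hx⟩, by simp⟩)
      exact ⟨e, fun h => absurd h hv, fun _ _ => ⟨hd, he⟩⟩
  obtain ⟨σ', hσ'⟩ := exists_adjLists hex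
  have hdeg' : G'.degree src = k := (exists_ordering G' src h hinj hrange).1
  refine ⟨σ', hdeg', fun i hi => ?_, fun v hv ht => ⟨((hσ' v).2 hv ht).1, fun i => ?_⟩⟩
  · by_cases hik : i < k
    · have h1 : listEntry σ src i = some (.inl (.inl (p ⟨i, hik⟩))) := hσ ⟨i, hik⟩
      have hJ : (⟨i, hik⟩ : Fin k) ∉ J := fun hJ => hi _ hJ rfl
      rw [h1, listEntry_of_lt σ' (by rwa [hdeg']), (hσ' src).1 rfl _ ⟨i, hik⟩ rfl, hh]
      simp only [if_neg hJ]
    · rw [listEntry_of_not_lt σ' (by rwa [hdeg']), listEntry_of_not_lt σ (by rwa [hdeg])]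
  · obtain ⟨hd, he⟩ := (hσ' v).2 hv ht
    by_cases hi : i < G.degree v
    · rw [listEntry_of_lt σ hi, listEntry_of_lt σ' (by rwa [hd]), he _ ⟨i, hi⟩ rfl]
    · rw [listEntry_of_not_lt σ hi, listEntry_of_not_lt σ' (by rwa [hd])]

theorem exists_source_positions (H : SimpleGraph S₁) (N₁ : Finset S₁)
    {G : SimpleGraph (Vert S₁ S₂)} (hG : G = sourceSinkGraph H N₁ (∅ : Finset S₂))
    (σ : AdjLists G) :
    G.degree src = N₁.card ∧
    ∃ p : Fin N₁.card → S₁, Function.Injective p ∧ Finset.univ.image p = N₁ ∧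
      ∀ j : Fin N₁.card, listEntry σ src j = some (.inl (.inl (p j))) := by
  have hadj : ∀ x, G.Adj src x ↔ ∃ u ∈ N₁, x = .inl (.inl u) := by
    rintro ((u | w) | (_ | _)) <;> simp [hG, src, sourceSinkGraph, SimpleGraph.fromRel_adj]
  have hdeg : G.degree src = N₁.card := by
    refine (exists_ordering G src (fun i => .inl (.inl (N₁.equivFin.symm i).1)) ?_ ?_).1
    · intro a b hab
      exact N₁.equivFin.symm.injective
        (Subtype.ext (Sum.inl_injective (Sum.inl_injective hab)))
    · intro x
      rw [hadj]
      constructor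
      · rintro ⟨j, rfl⟩; exact ⟨_, (N₁.equivFin.symm j).2, rfl⟩
      · rintro ⟨u, hu, rfl⟩; exact ⟨N₁.equivFin ⟨u, hu⟩, by simp⟩
  refine ⟨hdeg, ?_⟩
  have hex : ∀ j : Fin N₁.card, ∃ u ∈ N₁,
      (σ src (finCongr hdeg.symm j) : Vert S₁ S₂) = .inl (.inl u) :=
    fun j => (hadj _).1 (σ src (finCongr hdeg.symm j)).2
  choose p hpN hp using hex
  have hinj : Function.Injective p := by
    intro a b hab
    have h1 : (σ src (finCongr hdeg.symm a) : Vert S₁ S₂) = σ src (finCongr hdeg.symm b) := by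
      rw [hp, hp, hab]
    exact (finCongr hdeg.symm).injective ((σ src).injective (Subtype.ext h1))
  refine ⟨p, hinj, ?_, fun j => ?_⟩
  · refine Finset.eq_of_subset_of_card_le (fun u hu => ?_) ?_
    · obtain ⟨j, -, rfl⟩ := Finset.mem_image.1 hu
      exact hpN j
    · rw [Finset.card_image_of_injective _ hinj, Finset.card_univ, Fintype.card_fin]
  · rw [listEntry_of_lt σ (by rw [hdeg]; exact j.2), ← hp j]
    rfl

/-- Subtraction in `Fin k` wraps around, so the `k` intervals of length `b` cover every position
equally often. The two counts give the size of an interval and the number of intervals through a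
position. -/
theorem card_cyclic_interval {k b : ℕ} [NeZero k] (hb : b ≤ k) :
    (∀ i : Fin k, (Finset.univ.filter fun j : Fin k => ((j - i : Fin k) : ℕ) < b).card = b) ∧
    ∀ j : Fin k, (Finset.univ.filter fun i : Fin k => ((j - i : Fin k) : ℕ) < b).card = b := by
  have h0 : (Finset.univ.filter fun j : Fin k => (j : ℕ) < b).card = b := by
    rw [Fin.card_filter_val_lt, min_eq_right hb]
  constructor
  · intro i
    refine Eq.trans ?_ h0
    exact Finset.card_equiv (Equiv.subRight i) fun j => by simp
  · intro j
    refine Eq.trans ?_ h0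
    exact Finset.card_equiv (Equiv.subLeft j) fun i => by simp

theorem oracle_neighbor {V : Type} [Fintype V] [Nonempty V] (G : SimpleGraph V) (σ : AdjLists G)
    (u : V) (i : ℕ) : oracle G σ (.neighbor u i) = PMF.pure (.vertex (listEntry σ u i)) := rfl

/-- An algorithm that separates a graph of the first family from all graphs of the second family
makes at least `1 / (6 ε)` queries on it in expectation. -/
theorem le_expectedQueries_of_separates {α : Type} {H : SimpleGraph S₁} {ε : ℝ} {ds : ℕ}
    (hε : 0 < ε) (hε1 : ε < 1) (hds : 1 ≤ ε * ds) (hS₂ : ds ≤ Fintype.card S₂)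
    {N₁ : Finset S₁} (hN : N₁.card = ds) (σ : AdjLists (sourceSinkGraph H N₁ (∅ : Finset S₂)))
    (A : Algo (Vert S₁ S₂) α) {s s' : Set α} (hss : Disjoint s s')
    (hs : 2 / 3 ≤ A.successProb (oracle _ σ) s)
    (hs' : ∀ G ∈ Family₂ S₂ H ε ds, ∀ σ' : AdjLists G, 2 / 3 ≤ A.successProb (oracle G σ') s') :
    ENNReal.ofReal (1 / 6 / ε) ≤ A.expectedQueries (oracle _ σ) := by
  obtain ⟨hdeg, p, hp, hpN, hσ⟩ := exists_source_positions H N₁ rfl σ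
  subst hN
  generalize hk : N₁.card = k at *
  subst hpN
  have hk0 : 0 < k := by
    rcases Nat.eq_zero_or_pos k with h | h
    · rw [h] at hds; norm_num at hds
    · exact h
  have : NeZero k := ⟨hk0.ne'⟩
  have hkeep := keep_le_self hε hε1 k
  set b := k - keep ε k with hb
  obtain ⟨g⟩ : Nonempty (Fin k ↪ S₂) := by
    rw [Function.Embedding.nonempty_iff_card_le, Fintype.card_fin]
    exact hS₂
  obtain ⟨hcard, hcard'⟩ := card_cyclic_interval (b := b) (Nat.sub_le k (keep ε k))
  set J : Fin k → Finset (Fin k) := fun i =>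
    Finset.univ.filter fun j : Fin k => ((j - i : Fin k) : ℕ) < b with hJ
  choose σ' hdeg' hsrc huntouched using
    fun i => exists_swapped_adjLists H p g hp g.injective rfl σ hσ hdeg (J i)
  have hfam : ∀ i, sourceSinkGraph H ((J i)ᶜ.image p) ((J i).image g) ∈ Family₂ S₂ H ε k := by
    intro i
    refine ⟨_, _, ?_, ?_, rfl⟩
    · rw [Finset.card_image_of_injective _ hp, Finset.card_compl, hcard i, Fintype.card_fin]
      omega
    · rw [Finset.card_image_of_injective _ g.injective, hcard i]
  -- By injectivity of `p` and `g` a vertex belongs to at most one position `j`. For a vertex of no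
  -- position the value `0` is a dummy.
  have hvert : ∀ v : Vert S₁ S₂, ∃ j : Fin k, ∀ i, Touched p g (J i) v → j ∈ J i := by
    intro v
    by_cases hv : ∃ j : Fin k, v = .inl (.inl (p j)) ∨ v = .inl (.inr (g j))
    · obtain ⟨j, hj⟩ := hv
      refine ⟨j, fun i => ?_⟩
      rintro ⟨j', hj', hv'⟩
      have : j' = j := by
        rcases hj with rfl | rfl <;> rcases hv' with h | h
        · exact (hp (Sum.inl_injective (Sum.inl_injective h))).symm
        · cases h
        · cases h
        · exact (g.injective (Sum.inr_injective (Sum.inl_injective h))).symm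
      rwa [← this]
    · exact ⟨0, fun i ⟨j, _, hj⟩ => absurd ⟨j, hj⟩ hv⟩
  have hquery : ∀ q, ∃ j : Fin k, ∀ i, oracle _ (σ' i) q ≠ oracle _ σ q → j ∈ J i := by
    rintro (v | ⟨v, n⟩ | _)
    · by_cases hv : v = src
      · refine ⟨0, fun i h => absurd ?_ h⟩
        subst hv
        simp only [oracle, hdeg', hdeg]
      · obtain ⟨j, hj⟩ := hvert v
        refine ⟨j, fun i h => hj i ?_⟩
        by_contra ht
        exact h (by simp only [oracle, (huntouched i v hv ht).1])
    · by_cases hv : v = src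
      · subst hv
        by_cases hn : n < k
        · refine ⟨⟨n, hn⟩, fun i h => ?_⟩
          by_contra hJi
          refine h ?_
          rw [oracle_neighbor, oracle_neighbor, hsrc i n]
          rintro j hj rfl
          exact hJi hj
        · refine ⟨0, fun i h => absurd ?_ h⟩
          rw [oracle_neighbor, oracle_neighbor, hsrc i n]
          rintro j - rfl
          exact hn j.2
      · obtain ⟨j, hj⟩ := hvert v
        refine ⟨j, fun i h => hj i ?_⟩
        by_contra ht
        exact h (by rw [oracle_neighbor, oracle_neighbor, (huntouched i v hv ht).2])
    · exact ⟨0, fun i h => absurd rfl h⟩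
  have hcount : ∀ q, (Finset.univ.filter fun i => oracle _ (σ' i) q ≠ oracle _ σ q).card ≤ b := by
    intro q
    obtain ⟨j, hj⟩ := hquery q
    rw [← hcard' j]
    refine Finset.card_le_card fun i hi => ?_
    have := hj i (Finset.mem_filter.1 hi).2
    simpa [hJ] using this
  have hmain := A.card_le_mul_expectedQueries (oracle _ σ) (fun i => oracle _ (σ' i)) b hcount hss
    hs fun i => hs' _ (hfam i) (σ' i)
  rw [Fintype.card_fin] at hmain
  by_cases htop : A.expectedQueries (oracle _ σ) = ⊤
  · rw [htop]; exact le_top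
  rw [ENNReal.ofReal_le_iff_le_toReal htop]
  set T := A.expectedQueries (oracle _ σ)
  have hreal : (k : ℝ) ≤ 3 * b * T.toReal := by
    have := ENNReal.toReal_mono (by finiteness) hmain
    simpa using this
  have hT0 : 0 ≤ T.toReal := ENNReal.toReal_nonneg
  -- Rounding down adds less than 1 to `ε * k`, and `1 ≤ ε * k` absorbs it; hence the factor 2, and
  -- 6 in the final bound.
  have hbε : (b : ℝ) ≤ 2 * ε * k := by
    have h1 : (1 - ε) * k < keep ε k + 1 := Nat.lt_floor_add_one _
    rw [hb, Nat.cast_sub hkeep]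
    linarith
  have hk0' : (0 : ℝ) < k := by exact_mod_cast hk0
  rw [div_le_iff₀ hε]
  have h2 : (b : ℝ) * T.toReal ≤ 2 * ε * k * T.toReal := mul_le_mul_of_nonneg_right hbε hT0
  have h3 : (k : ℝ) * 1 ≤ k * (6 * (T.toReal * ε)) := by linarith
  linarith [le_of_mul_le_mul_left h3 hk0']

end Swap

end ERLower

namespace ERLower

/-! ### Hamming graphs as expanders -/

section Hamming

open scoped Classical
open SimpleGraph

variable {α β : Type} [Fintype α] [Fintype β]

/-- The average difference of a function over all pairs is controlled by the adjacent pairs. -/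
def L1Gap {V : Type} [Fintype V] (G : SimpleGraph V) (κ : ℝ) : Prop :=
  ∀ f : V → ℝ, ∑ x, ∑ y, |f x - f y| ≤ κ * ∑ x, ∑ y, if G.Adj x y then |f x - f y| else 0

theorem l1Gap_top {V : Type} [Fintype V] : L1Gap (⊤ : SimpleGraph V) 1 := by
  intro f
  rw [one_mul]
  refine Finset.sum_le_sum fun x _ => Finset.sum_le_sum fun y _ => ?_
  split_ifs with h
  · exact le_rfl
  · rw [top_adj, not_ne_iff] at h
    rw [h]; simp

theorem sum_adj_boxProd (G : SimpleGraph α) (H : SimpleGraph β) (F : α × β → α × β → ℝ) :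
    (∑ x, ∑ y, if (G □ H).Adj x y then F x y else 0) =
      (∑ b, ∑ a, ∑ a', if G.Adj a a' then F (a, b) (a', b) else 0) +
        ∑ a, ∑ b, ∑ b', if H.Adj b b' then F (a, b) (a, b') else 0 := by
  have hpt : ∀ x y : α × β, (if (G □ H).Adj x y then F x y else 0) =
      (if x.2 = y.2 then (if G.Adj x.1 y.1 then F x y else 0) else 0) +
        if x.1 = y.1 then (if H.Adj x.2 y.2 then F x y else 0) else 0 := by
    rintro ⟨a, b⟩ ⟨a', b'⟩
    simp only [boxProd_adj]
    by_cases h1 : a = a' <;> by_cases h2 : b = b' <;> simp [h1, h2]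
  simp only [hpt, Finset.sum_add_distrib, Fintype.sum_prod_type]
  congr 1
  · rw [Finset.sum_comm]
    simp
  · refine Finset.sum_congr rfl fun a _ => Finset.sum_congr rfl fun b _ => ?_
    rw [Finset.sum_comm]
    simp

/-- Between `(a, b)` and `(a', b')` the path through `(a', b)` changes one coordinate at a time. The
two parts use disjoint classes of edges of the product, so the constants enter through a maximum and
not through a sum. -/
theorem L1Gap.boxProd {G : SimpleGraph α} {H : SimpleGraph β} {κ₁ κ₂ κ : ℝ} (hG : L1Gap G κ₁)
    (hH : L1Gap H κ₂) (h1 : Fintype.card β * κ₁ ≤ κ) (h2 : Fintype.card α * κ₂ ≤ κ) :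
    L1Gap (G □ H) κ := by
  intro f
  rw [sum_adj_boxProd G H fun x y => |f x - f y|]
  simp only [Fintype.sum_prod_type]
  calc ∑ a, ∑ b, ∑ a', ∑ b', |f (a, b) - f (a', b')|
      ≤ ∑ a, ∑ b, ∑ a', ∑ b', (|f (a, b) - f (a', b)| + |f (a', b) - f (a', b')|) := by
        gcongr
        exact abs_sub_le _ _ _
    _ = Fintype.card β * ∑ b, ∑ a, ∑ a', |f (a, b) - f (a', b)| +
        Fintype.card α * ∑ a', ∑ b, ∑ b', |f (a', b) - f (a', b')| := by
        simp only [Finset.sum_add_distrib, Finset.sum_const, Finset.card_univ, nsmul_eq_mul]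
        congr 1
        · rw [Finset.sum_comm]
          simp only [Finset.mul_sum]
        · congr 1
          rw [Finset.sum_comm]
    _ ≤ Fintype.card β * (κ₁ * ∑ b, ∑ a, ∑ a', if G.Adj a a' then |f (a, b) - f (a', b)| else 0) +
        Fintype.card α *
          (κ₂ * ∑ a, ∑ b, ∑ b', if H.Adj b b' then |f (a, b) - f (a, b')| else 0) := by
        rw [Finset.mul_sum (a := κ₁), Finset.mul_sum (a := κ₂)]
        gcongr with b _ a _
        · exact hG fun a => f (a, b)
        · exact hH fun b => f (a, b)
    _ ≤ _ := by
        rw [mul_add, ← mul_assoc, ← mul_assoc]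
        gcongr

/-- The gap inequality for the indicator of `S`: both sides count each separated pair in its two
orders. -/
theorem L1Gap.card_mul_card_le {V : Type} [Fintype V] {G : SimpleGraph V} {κ : ℝ} (h : L1Gap G κ)
    (S : Finset V) : (S.card : ℝ) * (Fintype.card V - S.card) ≤ κ * cut G S := by
  have hpt : ∀ x y, |ind S x - ind S y| =
      ind S x * (1 - ind S y) + ind S y * (1 - ind S x) := by
    intro x y
    by_cases hx : x ∈ S <;> by_cases hy : y ∈ S <;> simp [ind, hx, hy]
  have h1 := h (ind S)
  have h2 : (∑ x, ∑ y, if G.Adj x y then |ind S x - ind S y| else 0) = 2 * cut G S := by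
    have h3 : (∑ x, ∑ y, if G.Adj x y then ind S y * (1 - ind S x) else 0) = (cut G S : ℝ) := by
      rw [cut_eq_sum, Finset.sum_comm]
      exact Finset.sum_congr rfl fun x _ => Finset.sum_congr rfl fun y _ => by rw [G.adj_comm]
    rw [two_mul]
    nth_rewrite 2 [← h3]
    rw [cut_eq_sum, ← Finset.sum_add_distrib]
    refine Finset.sum_congr rfl fun x _ => ?_
    rw [← Finset.sum_add_distrib]
    refine Finset.sum_congr rfl fun y _ => ?_
    rw [hpt]
    split_ifs <;> simp
  have h4 : ∑ x, ∑ y, |ind S x - ind S y| = 2 * (S.card * (Fintype.card V - S.card) : ℝ) := by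
    simp only [hpt, Finset.sum_add_distrib, ← Finset.mul_sum, ← Finset.sum_mul,
      Finset.sum_sub_distrib, sum_ind, Finset.sum_const, Finset.card_univ, nsmul_eq_mul]
    ring
  rw [h2, h4] at h1
  linarith

/-- The Hamming graph on words of length four over an alphabet with `q` letters. -/
def hamming (q : ℕ) : SimpleGraph ((Fin q × Fin q) × Fin q × Fin q) :=
  ((⊤ : SimpleGraph (Fin q)) □ (⊤ : SimpleGraph (Fin q))) □
    ((⊤ : SimpleGraph (Fin q)) □ (⊤ : SimpleGraph (Fin q)))

theorem degree_hamming (q : ℕ) (v : (Fin q × Fin q) × Fin q × Fin q) :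
    (hamming q).degree v = 4 * (q - 1) := by
  have h : (hamming q).degree v = (q - 1 + (q - 1)) + (q - 1 + (q - 1)) := by
    rw [hamming, degree_boxProd, degree_boxProd, degree_boxProd]
    simp only [complete_graph_degree, Fintype.card_fin]
  rw [h]; ring

theorem l1Gap_hamming (q : ℕ) : L1Gap (hamming q) ((q : ℝ) ^ 3) := by
  have h2 : L1Gap ((⊤ : SimpleGraph (Fin q)) □ (⊤ : SimpleGraph (Fin q))) (q : ℝ) :=
    l1Gap_top.boxProd l1Gap_top (by simp) (by simp)
  refine h2.boxProd h2 ?_ ?_ <;> simp only [Fintype.card_prod, Fintype.card_fin] <;> push_cast <;>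
    exact le_of_eq (by ring)

theorem le_conductance_hamming {q : ℕ} (hq : 2 ≤ q) : 1 / 8 ≤ conductance (hamming q) := by
  have : Nontrivial (Fin q) := Fin.nontrivial_iff_two_le.2 hq
  have hq' : (2 : ℝ) ≤ q := by exact_mod_cast hq
  have hd : ((4 * (q - 1) : ℕ) : ℝ) = 4 * (q - 1) := by
    rw [Nat.cast_mul, Nat.cast_sub (by omega)]; norm_num
  refine le_conductance (fun v => ?_) fun S T hT => ?_
  · rw [show (hamming q).degree v = 4 * (q - 1) by convert degree_hamming q v]
    omega
  have hreg : ∀ v, (hamming q).degree v = 4 * (q - 1) := fun v => degree_hamming q v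
  have hvol : ∀ S, (vol (hamming q) S : ℝ) = S.card * (4 * (q - 1)) := by
    intro S
    rw [vol_of_regular (d := 4 * (q - 1)) (by convert hreg) S, Nat.cast_mul, hd]
  have hgap := (l1Gap_hamming q).card_mul_card_le S
  have hTc : (T.card : ℝ) = Fintype.card ((Fin q × Fin q) × Fin q × Fin q) - S.card := by
    rw [← sum_ind T, Finset.sum_congr rfl fun v _ => ind_eq_one_sub hT v, Finset.sum_sub_distrib,
      sum_ind]
    simp
  have hn : (Fintype.card ((Fin q × Fin q) × Fin q × Fin q) : ℝ) = q ^ 4 := by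
    simp only [Fintype.card_prod, Fintype.card_fin]; push_cast; ring
  rw [hn] at hgap hTc
  rw [hvol, hvol, hTc, ← min_mul_of_nonneg _ _ (by linarith : (0 : ℝ) ≤ 4 * (q - 1))]
  set x : ℝ := (S.card : ℝ)
  have hx0 : 0 ≤ x := by positivity
  have hy0 : 0 ≤ (q : ℝ) ^ 4 - x := by rw [← hTc]; positivity
  set c : ℝ := (cut (hamming q) S : ℝ)
  have hq3 : (0 : ℝ) < (q : ℝ) ^ 3 := by positivity
  -- The larger of the two sides has at least `q ^ 4 / 2` vertices. Dividing by `q ^ 3` leaves `min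
  -- * q / 2 ≤ cut`, against degree `4 * (q - 1)`; this gives the conductance 1/8.
  have hmin : min x (q ^ 4 - x) * (q ^ 4 / 2) ≤ x * (q ^ 4 - x) := by
    rcases le_total x (q ^ 4 - x) with h | h
    · rw [min_eq_left h]
      exact mul_le_mul_of_nonneg_left (by linarith) hx0
    · rw [min_eq_right h, mul_comm]
      exact mul_le_mul_of_nonneg_right (by linarith) hy0
  have hm0 : 0 ≤ min x (q ^ 4 - x) := le_min hx0 hy0
  have h1 : q ^ 3 * (min x (q ^ 4 - x) * (q / 2)) ≤ (q : ℝ) ^ 3 * c := by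
    refine le_trans (le_of_eq ?_) (hmin.trans hgap)
    ring
  have h2 := le_of_mul_le_mul_left h1 hq3
  linarith

open Filter in
-- Words of length four give `q ^ 4` vertices of degree below `4 * q`, so `2 * d ^ 3 ≤ 128 * q ^ 3`
-- fits once `q ≥ 128`; length three would be too short. The source degree `ds` is fixed before `q`,
-- so the logarithmic conditions hold for large `q`.
theorem exists_admissible_hamming {K ε : ℝ} (N : ℕ) :
    ∃ q ds : ℕ, 2 ≤ q ∧ N ≤ Fintype.card ((Fin q × Fin q) × Fin q × Fin q) ∧
      Admissible (S₂ := Fin ds) (1 / 8) K ε (hamming q) (4 * (q - 1)) ds := by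
  obtain ⟨ds, hds⟩ := exists_nat_ge (K / ε)
  have hlin : Tendsto (fun q : ℕ => (q : ℝ)) atTop atTop := tendsto_natCast_atTop_atTop
  have ho1 : ∀ᶠ q : ℕ in atTop, ‖Real.log q‖ ≤ (1 / (4 * ds + 1)) * ‖(q : ℝ)‖ :=
    hlin.eventually (Real.isLittleO_log_id_atTop.bound (by positivity))
  have ho2 : ∀ᶠ q : ℕ in atTop, ‖Real.log q ^ 2‖ ≤ (1 / 16) * ‖(q : ℝ)‖ :=
    hlin.eventually ((Real.isLittleO_pow_log_id_atTop (n := 2)).bound (by norm_num))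
  have hK : ∀ᶠ q : ℕ in atTop, K * ds ≤ q := hlin.eventually_ge_atTop _
  obtain ⟨q, ⟨⟨⟨h1, h2⟩, h3⟩, h4⟩, h5⟩ :=
    ((((ho1.and ho2).and hK).and (eventually_ge_atTop 128)).and (eventually_ge_atTop N)).exists
  have hq : (128 : ℝ) ≤ q := by exact_mod_cast h4
  have hcard : Fintype.card ((Fin q × Fin q) × Fin q × Fin q) = q ^ 4 := by
    simp only [Fintype.card_prod, Fintype.card_fin]; ring
  have hd : ((4 * (q - 1) : ℕ) : ℝ) = 4 * (q - 1) := by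
    rw [Nat.cast_mul, Nat.cast_sub (by omega)]; norm_num
  have hlog0 : 0 ≤ Real.log q := Real.log_nonneg (by linarith)
  have hlog : Real.log ((q ^ 4 : ℕ) : ℝ) = 4 * Real.log q := by
    push_cast
    rw [Real.log_pow]; norm_num
  rw [Real.norm_of_nonneg hlog0, Real.norm_of_nonneg (by linarith)] at h1
  rw [Real.norm_of_nonneg (by positivity), Real.norm_of_nonneg (by linarith)] at h2
  have hq4 : q ≤ q ^ 4 := Nat.le_self_pow (by norm_num) q
  refine ⟨q, ds, by omega, by rw [hcard]; omega, ?_, ?_, hds, by simp, ?_, ?_, ?_, ?_⟩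
  · intro v
    convert degree_hamming q v
  · exact le_conductance_hamming (by omega)
  · rw [hcard, Fintype.card_fin]
    exact h3.trans (by exact_mod_cast hq4)
  · rw [hcard, hlog, hd]
    rw [one_div, inv_mul_eq_div, le_div_iff₀ (by positivity)] at h1
    nlinarith
  · rw [hcard, hlog, hd]
    nlinarith
  · rw [hcard]
    have : 4 * (q - 1) ≤ 4 * q := by omega
    calc 2 * (4 * (q - 1)) ^ 3 ≤ 2 * (4 * q) ^ 3 := by gcongr
      _ = 128 * q ^ 3 := by ring
      _ ≤ q * q ^ 3 := by gcongr
      _ = q ^ 4 := by ring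

end Hamming

end ERLower

namespace ERLower

/-! ### From approximation to separation -/

section Approximation

open scoped Classical

theorem nonempty_adjLists {V : Type} [Fintype V] (G : SimpleGraph V) :
    Nonempty (AdjLists G) :=
  ⟨fun v => Fintype.equivOfCardEq (by
    rw [SimpleGraph.card_neighborSet_eq_degree, Fintype.card_fin])⟩

theorem ApproximatesER.le_successProb_le {V : Type} [Fintype V] [Nonempty V] {φ ε : ℝ} {s t : V}
    {A : Algo V ℝ} (hA : ApproximatesER φ ε s t A) {G : SimpleGraph V} (σ : AdjLists G)
    (hG : φ ≤ conductance G) {y : ℝ} (hy : (1 + ε) * effRes G s t ≤ y) :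
    2 / 3 ≤ A.successProb (oracle G σ) (Set.Iic y) :=
  (hA G σ hG).trans (A.successProb_mono _ fun _ hx => hx.2.trans hy)

theorem ApproximatesER.le_successProb_gt {V : Type} [Fintype V] [Nonempty V] {φ ε : ℝ} {s t : V}
    {A : Algo V ℝ} (hA : ApproximatesER φ ε s t A) {G : SimpleGraph V} (σ : AdjLists G)
    (hG : φ ≤ conductance G) {y : ℝ} (hy : y < (1 - ε) * effRes G s t) :
    2 / 3 ≤ A.successProb (oracle G σ) (Set.Ioi y) :=
  (hA G σ hG).trans (A.successProb_mono _ fun _ hx => hy.trans_le hx.1)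

theorem disjoint_Iic_Ioi (y : ℝ) : Disjoint (Set.Iic y) (Set.Ioi y) :=
  Set.disjoint_left.2 fun _ h1 h2 => not_lt.2 (Set.mem_Iic.1 h1) (Set.mem_Ioi.1 h2)

variable {S₁ S₂ : Type} [Fintype S₁] [Fintype S₂]

/-- For small `ε`, approximating the resistance separates the two families for `16 ε`. -/
theorem le_expectedQueries_of_small {φ ε : ℝ} {H : SimpleGraph S₁} {d ds : ℕ} (hε : 0 < ε)
    (hε16 : 16 * ε < 1)
    (h : ParameterBounds φ (16 * ε) (Fintype.card S₁) (Fintype.card S₂) d ds)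
    (hreg : ∀ v, H.degree v = d) (hφ : 0 < φ) (hH : φ ≤ conductance H)
    {N₁ : Finset S₁} (hN : N₁.card = ds) (A : Algo (Vert S₁ S₂) ℝ)
    (hA : ApproximatesER (1 / (14 + 1 / φ)) ε src snk A)
    (σ : AdjLists (sourceSinkGraph H N₁ (∅ : Finset S₂))) :
    ENNReal.ofReal (1 / 96 / ε) ≤ A.expectedQueries (oracle _ σ) := by
  have hε' : 0 < 16 * ε := by linarith
  have e : 1 / 96 / ε = 1 / 6 / (16 * ε) := by field_simp; norm_num
  rw [e]
  have hcond := h.conductance_family₁ hreg hφ hH (N₁ := N₁) (by rw [hN]; exact h.ds_pos) hN.le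
  refine le_expectedQueries_of_separates hε' hε16 h.one_le h.ds_le hN σ A
    (disjoint_Iic_Ioi _) (hA.le_successProb_le σ hcond le_rfl) fun G hG σ' =>
    hA.le_successProb_gt σ' (h.conductance_family₂ hreg hφ hH hε' hε16 hG) ?_
  have hgap := h.effRes_gap hreg hφ hH hε' hε16 hN hG
  have h0 := effRes_nonneg (sourceSinkGraph H N₁ (∅ : Finset S₂)) src snk
  have h1 := mul_lt_mul_of_pos_left hgap (by linarith : 0 < 1 - ε)
  refine lt_of_le_of_lt ?_ h1
  -- The gap at `16 * ε` is a factor `1 + 4 ε`, and `(1 - ε) (1 + 4 ε) - (1 + ε) = ε (2 - 4 ε)`, so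
  -- the two ranges of allowed outputs are disjoint.
  have h2 : 0 ≤ ε * (2 - 4 * ε) * effRes (sourceSinkGraph H N₁ (∅ : Finset S₂)) src snk :=
    mul_nonneg (mul_nonneg hε.le (by linarith)) h0
  linarith

/-- Without queries one cannot tell apart a source of large degree and one of degree one. -/
theorem le_expectedQueries_of_large {φ δ ε : ℝ} {H : SimpleGraph S₁} {d ds : ℕ} (hε0 : 0 ≤ ε)
    (hε1 : ε < 1) (hδ1 : δ < 1)
    (h : ParameterBounds φ δ (Fintype.card S₁) (Fintype.card S₂) d ds)
    (hds : 4 / (1 - ε) ≤ ds) (hreg : ∀ v, H.degree v = d) (hφ : 0 < φ) (hH : φ ≤ conductance H)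
    {N₁ : Finset S₁} (hN : N₁.card = ds) (A : Algo (Vert S₁ S₂) ℝ)
    (hA : ApproximatesER (1 / (14 + 1 / φ)) ε src snk A)
    (σ : AdjLists (sourceSinkGraph H N₁ (∅ : Finset S₂))) :
    ENNReal.ofReal (1 / 6) ≤ A.expectedQueries (oracle _ σ) := by
  have hds0 := h.ds_pos
  have hdsR : (0 : ℝ) < ds := by exact_mod_cast hds0
  obtain ⟨u, hu⟩ : N₁.Nonempty := Finset.card_pos.1 (by omega)
  have hcond := h.conductance_family₁ hreg hφ hH (N₁ := N₁) (by omega) hN.le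
  have hcond' := h.conductance_family₁ hreg hφ hH (N₁ := {u}) (by simp)
    (by rw [Finset.card_singleton]; exact hds0)
  have hr1 := h.effRes_family₁_le (S₂ := S₂) hreg hφ hH hδ1 hN
  have hr2 := one_div_le_effRes_sourceSinkGraph H (N₁ := {u}) (N₂ := (∅ : Finset S₂)) (by simp)
    (lt_of_lt_of_le (by positivity) hcond')
  simp only [Finset.card_singleton, Finset.card_empty, Nat.cast_one, Nat.cast_zero, zero_div,
    add_zero, div_one] at hr2
  obtain ⟨σ'⟩ := nonempty_adjLists (sourceSinkGraph H {u} (∅ : Finset S₂))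
  have hgap : (1 + ε) * effRes (sourceSinkGraph H N₁ (∅ : Finset S₂)) src snk <
      (1 - ε) * effRes (sourceSinkGraph H {u} (∅ : Finset S₂)) src snk := by
    -- Here `(1 - ε) ds ≥ 4` and `1 - δ / 8 ≥ 7 / 8`, with product at least 7/2. Since `(1 + ε) * (2
    -- / 7) < 1`, the resistance, at least 1, for a source of degree one is far enough away.
    have h1 : (1 / (ds * (1 - δ / 8)) : ℝ) ≤ (1 - ε) * (2 / 7) := by
      rw [div_le_iff₀ (mul_pos hdsR (by linarith))]
      have h3 : 4 ≤ (1 - ε) * ds := by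
        have := (div_le_iff₀ (by linarith)).1 hds
        linarith
      nlinarith
    have h2 := mul_le_mul_of_nonneg_left hr2 (by linarith : 0 ≤ 1 - ε)
    have h3 := mul_le_mul_of_nonneg_left (hr1.trans h1) (by linarith : 0 ≤ 1 + ε)
    nlinarith
  -- With a single alternative graph and `b = 1` the hypothesis on changed answers is void, and the
  -- expected number of queries is at least 1/3.
  have hmain := A.card_le_mul_expectedQueries (ι := Unit) (oracle _ σ) (fun _ => oracle _ σ') 1
    (fun q => (Finset.card_le_univ _).trans (by simp)) (disjoint_Iic_Ioi _)
    (hA.le_successProb_le σ hcond le_rfl) fun _ => hA.le_successProb_gt σ' hcond' hgap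
  rw [Fintype.card_unit] at hmain
  by_cases htop : A.expectedQueries (oracle _ σ) = ⊤
  · rw [htop]; exact le_top
  rw [ENNReal.ofReal_le_iff_le_toReal htop]
  have := ENNReal.toReal_mono (by finiteness) hmain
  simp at this
  linarith

end Approximation

end ERLower

/-! ### Assembly of the three statements -/

theorem theorem2 :
    (∃ φ c : ℝ, 0 < φ ∧ 0 < c ∧ ∀ ε : ℝ, 0 < ε → ε < 1 → ∀ N : ℕ,
      ∃ (V : Type) (_ : Fintype V) (_ : Nonempty V) (G : SimpleGraph V) (s t : V),
        N ≤ Fintype.card V ∧ φ ≤ ERLower.conductance G ∧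
        ∀ A : ERLower.Algo V ℝ, ERLower.ApproximatesER φ ε s t A →
          ∀ σ : ERLower.AdjLists G,
            ENNReal.ofReal (c / ε) ≤ A.expectedQueries (ERLower.oracle G σ)) ∧
    (∃ c : ℝ, 0 < c ∧ ∀ φ : ℝ, 0 < φ → ∃ K φ' : ℝ, 0 < K ∧ 0 < φ' ∧
      ∀ ε : ℝ, 0 < ε → ε < 1 →
      ∀ (S₁ S₂ : Type) [Fintype S₁] [Fintype S₂] (H : SimpleGraph S₁) (d ds : ℕ),
        ERLower.Admissible (S₂ := S₂) φ K ε H d ds →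
        (∀ G₁ ∈ ERLower.Family₁ S₂ H ds, ∀ G₂ ∈ ERLower.Family₂ S₂ H ε ds,
          φ' ≤ ERLower.conductance G₁ ∧ φ' ≤ ERLower.conductance G₂ ∧
          ε / 4 * ERLower.effRes G₁ ERLower.src ERLower.snk <
            |ERLower.effRes G₁ ERLower.src ERLower.snk -
              ERLower.effRes G₂ ERLower.src ERLower.snk|) ∧
        (∀ A : ERLower.Algo (ERLower.Vert S₁ S₂) Bool,
          ERLower.Distinguishes (ERLower.Family₁ S₂ H ds) (ERLower.Family₂ S₂ H ε ds) A →
          ∀ G₁ ∈ ERLower.Family₁ S₂ H ds, ∀ σ : ERLower.AdjLists G₁,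
            ENNReal.ofReal (c / ε) ≤ A.expectedQueries (ERLower.oracle G₁ σ))) ∧
    (∃ φ : ℝ, 0 < φ ∧ ∀ K ε : ℝ, 0 < K → 0 < ε → ε < 1 → ∀ N : ℕ,
      ∃ (S₁ S₂ : Type) (_ : Fintype S₁) (_ : Fintype S₂) (H : SimpleGraph S₁) (d ds : ℕ),
        N ≤ Fintype.card S₁ ∧ ERLower.Admissible (S₂ := S₂) φ K ε H d ds) := by
  refine ⟨⟨1 / (14 + 1 / (1 / 8)), 1 / 96, by norm_num, by norm_num, ?_⟩,
    ⟨1 / 6, by norm_num, ?_⟩, ⟨1 / 8, by norm_num, ?_⟩⟩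
  · intro ε hε hε1 N
    have hφ : (0 : ℝ) < 1 / 8 := by norm_num
    -- The families need a parameter `16 * ε` below 1. Otherwise `1 / 96 / ε ≤ 1 / 6`, and a
    -- constant bound is enough.
    rcases lt_or_ge (16 * ε) 1 with h16 | h16
    · obtain ⟨q, ds, hq, hN, hadm⟩ :=
        ERLower.exists_admissible_hamming (K := 16 + 64 / (1 / 8) ^ 2) (ε := 16 * ε) N
      have hb := hadm.parameterBounds hφ (by linarith) le_rfl
      obtain ⟨N₁, hN₁⟩ := hb.exists_card_eq
      refine ⟨ERLower.Vert ((Fin q × Fin q) × Fin q × Fin q) (Fin ds), inferInstance,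
        inferInstance, ERLower.sourceSinkGraph (ERLower.hamming q) N₁ ∅, ERLower.src, ERLower.snk,
        ?_, ?_, ?_⟩
      · exact hN.trans (by simp only [Fintype.card_sum]; omega)
      · exact hb.conductance_family₁ hadm.regular hφ hadm.expander
          (by rw [hN₁]; exact hb.ds_pos) hN₁.le
      · exact fun A hA σ => ERLower.le_expectedQueries_of_small hε h16 hb hadm.regular hφ
          hadm.expander hN₁ A hA σ
    -- The parameter 1/2 is arbitrary, as only the first family is used. The extra `4 / (1 - ε)` in
    -- `K` makes `ds` large when `ε` is close to 1.
    · obtain ⟨q, ds, hq, hN, hadm⟩ := ERLower.exists_admissible_hamming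
        (K := 16 + 64 / (1 / 8) ^ 2 + 4 / (1 - ε)) (ε := 1 / 2) N
      have h4 : 0 ≤ 4 / (1 - ε) := div_nonneg (by norm_num) (by linarith)
      have hb := hadm.parameterBounds hφ (by norm_num) (by linarith)
      obtain ⟨N₁, hN₁⟩ := hb.exists_card_eq
      have hds : 4 / (1 - ε) ≤ ds := by
        have := hadm.source_large
        norm_num at this ⊢
        linarith
      refine ⟨ERLower.Vert ((Fin q × Fin q) × Fin q × Fin q) (Fin ds), inferInstance,
        inferInstance, ERLower.sourceSinkGraph (ERLower.hamming q) N₁ ∅, ERLower.src, ERLower.snk,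
        ?_, ?_, ?_⟩
      · exact hN.trans (by simp only [Fintype.card_sum]; omega)
      · exact hb.conductance_family₁ hadm.regular hφ hadm.expander
          (by rw [hN₁]; exact hb.ds_pos) hN₁.le
      · intro A hA σ
        refine le_trans (ENNReal.ofReal_le_ofReal ?_) (ERLower.le_expectedQueries_of_large hε.le hε1
          (by norm_num) hb hds hadm.regular hφ hadm.expander hN₁ A hA σ)
        rw [div_le_iff₀ hε]
        linarith
  · intro φ hφ
    refine ⟨16 + 64 / φ ^ 2, 1 / (14 + 1 / φ), by positivity, by positivity, ?_⟩
    intro ε hε hε1 S₁ S₂ _ _ H d ds hadm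
    have hb := hadm.parameterBounds hφ hε le_rfl
    refine ⟨?_, ?_⟩
    · rintro G₁ ⟨N₁, hN₁, rfl⟩ G₂ hG₂
      refine ⟨hb.conductance_family₁ hadm.regular hφ hadm.expander
        (by rw [hN₁]; exact hb.ds_pos) hN₁.le,
        hb.conductance_family₂ hadm.regular hφ hadm.expander hε hε1 hG₂, ?_⟩
      have hgap := hb.effRes_gap hadm.regular hφ hadm.expander hε hε1 hN₁ hG₂
      rw [abs_sub_comm]
      exact lt_of_lt_of_le (by linarith) (le_abs_self _)
    · rintro A hA _ ⟨N₁, hN₁, rfl⟩ σ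
      exact ERLower.le_expectedQueries_of_separates hε hε1 hb.one_le hb.ds_le hN₁ σ A
        (by simp) (hA.1 _ ⟨N₁, hN₁, rfl⟩ σ) hA.2
  · intro K ε _ _ _ N
    obtain ⟨q, ds, -, hN, hadm⟩ := ERLower.exists_admissible_hamming (K := K) (ε := ε) N
    exact ⟨(Fin q × Fin q) × Fin q × Fin q, Fin ds, inferInstance, inferInstance,
      ERLower.hamming q, 4 * (q - 1), ds, hN, hadm⟩
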